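/- **Setting.** Let $X,Y$ be real separable Hilbert spaces, $(\Omega,\mathcal F,\mathbb P)$ a probability space, $H\in(\tfrac12,1)$, $T>0$, $\tau>0$. *Noise.* Let $(e_n)$ be a complete orthonormal basis of $Y$, $Q\in\mathcal L(Y)$ with $Qe_n=\lambda_ne_n$, $\lambda_n\ge 0$, $\sum_n\lambda_n<\infty$, let $\beta^H_n$ be independent real standard fractional Brownian motions on $[0,T]$ with Hurst parameter $H$ (centred Gaussian processes with continuous paths and covariance $\frac12(t^{2H}+s^{2H}-|t-s|^{2H})$), and $B^H(t)=\sum_n\sqrt{\lambda_n}\,\beta^H_n(t)\,e_n$. An operator $\psi\in\mathcal L(Y,X)$ is in $\mathcal L_2^0$ if $\|\psi\|^2_{\mathcal L_2^0}:=\sum_n\|\sqrt{\lambda_n}\,\psi e_n\|^2<\infty$. For measurable $\Phi:[0,t]\to\mathcal L_2^0$, put $\int_0^t\Phi\,dB^H:=\sum_n\int_0^t\sqrt{\lambda_n}\,\Phi(s)e_n\,d\beta_n^H(s)$ (sum in $L^2(\Omega,X)$), where the Wiener integral $\int_0^t\psi\,d\beta^H_n$ of $\psi:[0,t]\to X$ is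 the $L^2(\Omega,X)$-limit of the elementary integrals $\sum_i(\beta^H_n(b_i)-\beta^H_n(a_i))c_i$ of step functions $\sum_i 1_{(a_i,b_i]}c_i$ that converge to $\psi$ in the norm $\|\psi\|^2=H(2H-1)\int_0^t\int_0^t\|\psi(u)\|\|\psi(v)\||u-v|^{2H-2}du\,dv$. *Evolution family.* Let $A(t)$, $t\in[0,T]$, be closed densely defined linear operators in $X$ with a common domain, generating an evolution family $\{U(t,s):0\le s\le t\le T\}\subset\mathcal L(X)$. That is, $U(s,s)=I$, $U(t,s)U(s,r)=U(t,r)$ for $r\le s\le t$, and $(t,s)\mapsto U(t,s)x$ is continuous on $0\le s\le t\le T$ for every $x\in X$; for $s<t$ and $x\in X$, $U(t,s)x\in D(A(t))$ and $\partial_tU(t,s)x=A(t)U(t,s)x$; for $s<t$ and $x\in D(A(s))$, $\partial_s^+U(t,s)x=-U(t,s)A(s)x$. **Assumptions.** (H.1) There are $\beta>0$, $M\ge1$, $M_*>0$ with $\|U(t,s)\|\le Me^{-\beta(t-s)}$ for $0\le s\le t\le T$; and each $A(t)$, $t\in[0,T]$, has an everywhere defined bounded inverse with $\|A(t)^{-1}\|\le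 M_*$. (H.2) $f,g:[0,T]\times X\to X$ are continuous, $g(t,x)\in D(A(t))$, and there are $C_1,C_2>0$ such that for all $t\in[0,T]$, $x,y\in X$: $\|f(t,x)-f(t,y)\|\vee\|g(t,x)-g(t,y)\|\le C_1\|x-y\|$ and $\|f(t,x)\|^2\vee\|g(t,x)\|^2\vee\|A(t)g(t,x)\|^2\le C_2(1+\|x\|^2)$. (H.3) There is $0<L_*<1/M_*$ with $\|A(t)g(t,x)-A(t)g(t,y)\|\le L_*\|x-y\|$ for all $t\in[0,T]$, $x,y\in X$; and $\lim_{t\to s}\mathbb E\|g(t,y(t))-g(s,y(s))\|^2=0$ for all $y\in C([0,T],L^2(\Omega,X))$ and $s\in[0,T]$. (H.4) $\sigma:[0,T]\to\mathcal L_2^0$ is measurable and bounded in $\|\cdot\|_{\mathcal L_2^0}$; $r,\rho:[0,T]\to\mathbb R$ are continuous with $-\tau\le t-r(t)\le t$ and $-\tau\le t-\rho(t)\le t$ for all $t\in[0,T]$; and $\varphi\in C([-\tau,0],L^2(\Omega,X))$. **Theorem.** Under (H.1)–(H.4) the equation $$d[x(t)+g(t,x(t-r(t)))]=[A(t)x(t)+f(t,x(t-\rho(t)))]\,dt+\sigma(t)\,dB^H(t),\quad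 0\le t\le T,\qquad x=\varphi\ \text{on}\ [-\tau,0],$$ has a unique mild solution on $[-\tau,T]$. That is, there is exactly one $x\in C([-\tau,T],L^2(\Omega,X))$ with $x(t)=\varphi(t)$ for $t\in[-\tau,0]$ such that for every $t\in[0,T]$, $\mathbb P$-a.s., $$x(t)=U(t,0)\big(\varphi(0)+g(0,\varphi(-r(0)))\big)-g(t,x(t-r(t)))-\int_0^tU(t,s)A(s)g(s,x(s-r(s)))\,ds+\int_0^tU(t,s)f(s,x(s-\rho(s)))\,ds+\int_0^tU(t,s)\sigma(s)\,dB^H(s),$$ where the two $ds$-integrals are Bochner integrals in $L^2(\Omega,X)$ and all integrals exist. -/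

import Mathlib

open MeasureTheory ProbabilityTheory Set Filter Topology
open scoped ENNReal NNReal

noncomputable section

namespace NeutralFBM

/-! ### Evolution families and their generators -/

section Evolution

variable {X : Type*} [NormedAddCommGroup X] [NormedSpace ℝ X]

/-- `U t s`, `0 ≤ s ≤ t ≤ T`, is a (strongly continuous) evolution family of bounded operators.
Values of `U` outside the triangle `0 ≤ s ≤ t ≤ T` are irrelevant. -/
structure IsEvolutionFamily (T : ℝ) (U : ℝ → ℝ → X →L[ℝ] X) : Prop where
  self : ∀ s ∈ Icc 0 T, U s s = ContinuousLinearMap.id ℝ X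
  comp : ∀ r s t, 0 ≤ r → r ≤ s → s ≤ t → t ≤ T → (U t s).comp (U s r) = U t r
  strongly_continuous : ∀ x : X,
    ContinuousOn (fun p : ℝ × ℝ => U p.1 p.2 x) {p | 0 ≤ p.2 ∧ p.2 ≤ p.1 ∧ p.1 ≤ T}

/-- The family `A t`, `t ∈ [0,T]`, of closed, densely defined linear operators with a common domain
generates the evolution family `U`: one has `∂ₜ U(t,s) x = A(t) U(t,s) x` for `s < t` and every
`x`, and `∂ₛ⁺ U(t,s) x = - U(t,s) A(s) x` for `s < t` and `x` in the domain of `A(s)`. -/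
structure Generates (T : ℝ) (A : ℝ → X →ₗ.[ℝ] X) (U : ℝ → ℝ → X →L[ℝ] X) : Prop where
  closed : ∀ t ∈ Icc 0 T, (A t).IsClosed
  dense : ∀ t ∈ Icc 0 T, Dense ((A t).domain : Set X)
  domain_eq : ∀ s ∈ Icc 0 T, ∀ t ∈ Icc 0 T, (A s).domain = (A t).domain
  evolution : IsEvolutionFamily T U
  deriv_left : ∀ s t, 0 ≤ s → s < t → t ≤ T → ∀ x : X, ∃ h : U t s x ∈ (A t).domain,
    HasDerivWithinAt (fun r => U r s x) (A t ⟨U t s x, h⟩) (Icc s T) t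
  deriv_right : ∀ s t, 0 ≤ s → s < t → t ≤ T → ∀ x : (A s).domain,
    HasDerivWithinAt (fun r => U t r (x : X)) (-(U t s (A s x))) (Icc s t) s

/-- The bounded operator `R` is the (everywhere defined) inverse of the unbounded operator `A`. -/
def IsInverse (A : X →ₗ.[ℝ] X) (R : X →L[ℝ] X) : Prop :=
  (∀ y : X, ∃ h : R y ∈ A.domain, A ⟨R y, h⟩ = y) ∧ ∀ x : A.domain, R (A x) = x

end Evolution

/-! ### Fractional Brownian motion -/

section Noise

variable {Ω : Type*} [MeasurableSpace Ω]

/-- `β` restricted to the times `[0,T]` is a standard real fractional Brownian motion with Hurst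
parameter `H`: a centred Gaussian process with continuous sample paths and the covariance
`(t^(2H) + s^(2H) - |t - s|^(2H)) / 2`. -/
structure IsFBM (H T : ℝ) (P : Measure Ω) (β : ℝ → Ω → ℝ) : Prop where
  gaussian : IsGaussianProcess (fun (t : Icc (0 : ℝ) T) ω => β t ω) P
  mean_zero : ∀ t ∈ Icc 0 T, ∫ ω, β t ω ∂P = 0
  covariance : ∀ t ∈ Icc 0 T, ∀ s ∈ Icc 0 T,
    ∫ ω, β t ω * β s ω ∂P = (t ^ (2 * H) + s ^ (2 * H) - |t - s| ^ (2 * H)) / 2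
  continuous_paths : ∀ᵐ ω ∂P, ContinuousOn (fun t => β t ω) (Icc 0 T)

/-- A `Q`-fractional Brownian motion `B(t) = ∑ₙ √λₙ βₙ(t) eₙ`, `t ∈ [0,T]`, in the Hilbert space
`Y`: here `(eₙ)` is a complete orthonormal basis of `Y` with `Q eₙ = λₙ eₙ`, `λₙ ≥ 0`,
`∑ₙ λₙ < ∞`, and the `βₙ` are independent standard fractional Brownian motions. -/
structure QFBM (H T : ℝ) (P : Measure Ω) (ι : Type*) (Y : Type*) [NormedAddCommGroup Y]
    [InnerProductSpace ℝ Y] where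
  e : HilbertBasis ι ℝ Y
  Q : Y →L[ℝ] Y
  lam : ι → ℝ
  lam_nonneg : ∀ n, 0 ≤ lam n
  Q_apply : ∀ n, Q (e n) = lam n • e n
  trace_class : Summable lam
  β : ι → ℝ → Ω → ℝ
  fbm : ∀ n, IsFBM H T P (β n)
  indep : iIndepFun (fun n ω (t : Icc (0 : ℝ) T) => β n t ω) P

/-- The `Y`-valued process `B(t) = ∑ₙ √λₙ βₙ(t) eₙ` itself. -/
def QFBM.process {H T : ℝ} {P : Measure Ω} {ι Y : Type*} [NormedAddCommGroup Y]
    [InnerProductSpace ℝ Y] (B : QFBM H T P ι Y) (t : ℝ) (ω : Ω) : Y :=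
  ∑' n, (Real.sqrt (B.lam n) * B.β n t ω) • B.e n

/-! ### Wiener integrals -/

variable {X : Type*} [NormedAddCommGroup X] [NormedSpace ℝ X]

/-- Data of an `X`-valued step function `∑ᵢ 1_(aᵢ,bᵢ] cᵢ` on `[0,t]`. -/
structure StepData (X : Type*) (t : ℝ) where
  n : ℕ
  a : Fin n → ℝ
  b : Fin n → ℝ
  c : Fin n → X
  nonneg : ∀ i, 0 ≤ a i
  le : ∀ i, a i ≤ b i
  le_end : ∀ i, b i ≤ t

/-- The step function `∑ᵢ 1_(aᵢ,bᵢ] cᵢ`. -/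
def StepData.toFun {t : ℝ} (S : StepData X t) (s : ℝ) : X :=
  ∑ i, (Ioc (S.a i) (S.b i)).indicator (fun _ => S.c i) s

/-- The elementary integral `∑ᵢ (β(bᵢ) - β(aᵢ)) cᵢ` of a step function. -/
def StepData.integral {t : ℝ} (S : StepData X t) (β : ℝ → Ω → ℝ) (ω : Ω) : X :=
  ∑ i, (β (S.b i) ω - β (S.a i) ω) • S.c i

/-- The squared norm
`H (2H - 1) ∫₀ᵗ ∫₀ᵗ ‖ψ(u)‖ ‖ψ(v)‖ |u - v|^(2H - 2) du dv` of the function space `|𝓗|`. -/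
def hNormSq (H t : ℝ) (ψ : ℝ → X) : ℝ≥0∞ :=
  ENNReal.ofReal (H * (2 * H - 1)) *
    ∫⁻ u in Icc 0 t, ∫⁻ v in Icc 0 t, ‖ψ u‖ₑ * ‖ψ v‖ₑ * ENNReal.ofReal (|u - v| ^ (2 * H - 2))

/-- `I = ∫₀ᵗ ψ(s) dβ(s)`, the Wiener integral of the deterministic function `ψ : [0,t] → X`:
the extension of `1_[0,s] x ↦ β(s) x` by linearity and by the isometry, i.e. `I` is the
limit in `L²(Ω, X)` of the elementary integrals of step functions converging to `ψ` in `|𝓗|`. -/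
def IsWienerIntegral (H : ℝ) (P : Measure Ω) (β : ℝ → Ω → ℝ) (t : ℝ) (ψ : ℝ → X)
    (I : Lp X 2 P) : Prop :=
  AEStronglyMeasurable ψ (volume.restrict (Icc 0 t)) ∧
  ∃ S : ℕ → StepData X t,
    Tendsto (fun k => hNormSq H t (fun s => ψ s - (S k).toFun s)) atTop (𝓝 0) ∧
    Tendsto (fun k => eLpNorm (fun ω => (S k).integral β ω - I ω) 2 P) atTop (𝓝 0)

variable {H T : ℝ} {P : Measure Ω} {ι Y : Type*} [NormedAddCommGroup Y] [InnerProductSpace ℝ Y]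

/-- `ψ : Y → X` is a `Q`-Hilbert–Schmidt operator: `∑ₙ ‖√λₙ ψ eₙ‖² < ∞`. -/
def QFBM.IsQHilbertSchmidt (B : QFBM H T P ι Y) (ψ : Y →L[ℝ] X) : Prop :=
  Summable fun n => ‖Real.sqrt (B.lam n) • ψ (B.e n)‖ ^ 2

/-- The `Q`-Hilbert–Schmidt norm `(∑ₙ ‖√λₙ ψ eₙ‖²)^(1/2)`. -/
def QFBM.qNorm (B : QFBM H T P ι Y) (ψ : Y →L[ℝ] X) : ℝ :=
  Real.sqrt (∑' n, ‖Real.sqrt (B.lam n) • ψ (B.e n)‖ ^ 2)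

/-- `Z = ∫₀ᵗ Φ(s) dB(s) = ∑ₙ ∫₀ᵗ √λₙ Φ(s) eₙ dβₙ(s)`, the sum converging in `L²(Ω, X)`. -/
def QFBM.IsStochasticIntegral (B : QFBM H T P ι Y) (t : ℝ) (Φ : ℝ → Y →L[ℝ] X)
    (Z : Lp X 2 P) : Prop :=
  ∃ I : ι → Lp X 2 P,
    (∀ n, IsWienerIntegral H P (B.β n) t
      (fun s => Real.sqrt (B.lam n) • Φ s (B.e n)) (I n)) ∧
    HasSum I Z

end Noise

/-! ### Mild solutions -/

section Mild

variable {Ω : Type*} [MeasurableSpace Ω] {P : Measure Ω}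
  {X : Type*} [NormedAddCommGroup X] [NormedSpace ℝ X]
  {ι Y : Type*} [NormedAddCommGroup Y] [InnerProductSpace ℝ Y] {H T : ℝ}

/-- `x : [-τ,T] → L²(Ω, X)` is a mild solution of
`d[x(t) + g(t, x(t - r(t)))] = [A(t) x(t) + f(t, x(t - ρ(t)))] dt + σ(t) dB(t)` on `[0,T]`,
`x = φ` on `[-τ,0]`. Identities in `Lp X 2 P` are `P`-almost sure identities; the random variables
`G s = g(s, x(s - r(s)))`, `AG s = A(s) g(s, x(s - r(s)))`, `F s = f(s, x(s - ρ(s)))` and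
`G₀ = g(0, φ(-r(0)))` are required to lie in `L²(Ω, X)`, and the two `ds`-integrals are Bochner
integrals in `L²(Ω, X)`, whose integrands are required to be integrable. -/
def IsMildSolution (τ : ℝ) (A : ℝ → X →ₗ.[ℝ] X) (U : ℝ → ℝ → X →L[ℝ] X) (f g : ℝ → X → X)
    (r ρ : ℝ → ℝ) (σ : ℝ → Y →L[ℝ] X) (B : QFBM H T P ι Y) (φ : ℝ → Lp X 2 P)
    (x : ℝ → Lp X 2 P) : Prop :=
  ContinuousOn x (Icc (-τ) T) ∧
  (∀ t ∈ Icc (-τ) 0, x t = φ t) ∧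
  ∃ (G₀ : Lp X 2 P) (G AG F Z : ℝ → Lp X 2 P),
    (∀ᵐ ω ∂P, G₀ ω = g 0 (φ (-r 0) ω)) ∧
    (∀ s ∈ Icc 0 T, ∀ᵐ ω ∂P, G s ω = g s (x (s - r s) ω)) ∧
    (∀ s ∈ Icc 0 T, ∀ᵐ ω ∂P, ∃ h : g s (x (s - r s) ω) ∈ (A s).domain,
      AG s ω = A s ⟨g s (x (s - r s) ω), h⟩) ∧
    (∀ s ∈ Icc 0 T, ∀ᵐ ω ∂P, F s ω = f s (x (s - ρ s) ω)) ∧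
    ∀ t ∈ Icc 0 T,
      IntervalIntegrable (fun s => (U t s).compLp (AG s)) volume 0 t ∧
      IntervalIntegrable (fun s => (U t s).compLp (F s)) volume 0 t ∧
      B.IsStochasticIntegral t (fun s => (U t s).comp (σ s)) (Z t) ∧
      x t = (U t 0).compLp (φ 0 + G₀) - G t
        - (∫ s in (0 : ℝ)..t, (U t s).compLp (AG s))
        + (∫ s in (0 : ℝ)..t, (U t s).compLp (F s))
        + Z t

end Mild

end NeutralFBM

end

namespace NeutralFBM

/-! ### Measurability of Carathéodory functions -/

/-! The noise is additive, so it enters the mild equation only through the function `Z t = ∫₀ᵗ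
U(t,s) σ(s) dB(s)`. Once `Z` is known to exist, to be unique and to be continuous in mean square,
the equation is a deterministic delay equation in the Banach space `L²(Ω, X)`. There `U` acts
through `compLpL`, the coefficients act through `superposition`, and a fixed point argument applies
(`exists_unique_neutral`).

The neutral term has no integral to make it small. Writing `g = A⁻¹(A g)` bounds its Lipschitz
constant by `Mstar * Lstar < 1`. In the norm weighted by `exp (-l t)` the two integral terms have
Lipschitz constant of order `1 / l`, and delays cost nothing because the weight `exp (l t)`
increases. For large `l` the map is therefore a contraction on all of `[-τ,T]` at once
(`exists_unique_of_weighted_contraction`).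

For the noise, the covariance of increments is the integral of `H (2H - 1) |u - v| ^ (2H - 2)` over
a rectangle. This kernel is bounded on `L²([0,T])` by the Schur test, so elementary integrals extend
to a bounded operator `wienerMap`. The operator is also bounded by the `|𝓗|` norm, which forces
every limit allowed by the definition to agree with it (`isWienerIntegral_iff`). Independence makes
the coordinate integrals orthogonal, so their series is controlled by the Hilbert–Schmidt norm, and
dominated convergence gives continuity in `t` (`continuousOn_of_isStochasticIntegral_evolution`).

A separate difficulty is measurability of `s ↦ U(t,s) A(s) g(s,c)`, since no regularity of `s ↦
A(s)` is assumed. It is recovered from the right derivative of `U(t,s)` in `s`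
(`Generates.aestronglyMeasurable_apply_generator`) and then transferred to `L²(Ω, X)` by
approximating in `ω`. -/

theorem aestronglyMeasurable_apply_of_continuous {S E F : Type*} [MeasurableSpace S]
    [TopologicalSpace E] [TopologicalSpace F] [TopologicalSpace.PseudoMetrizableSpace F]
    {μ : Measure S} {Ψ : S → E → F} (hc : ∀ᵐ s ∂μ, Continuous (Ψ s))
    (hm : ∀ y, AEStronglyMeasurable (fun s => Ψ s y) μ) {z : S → E}
    (hz : AEStronglyMeasurable z μ) : AEStronglyMeasurable (fun s => Ψ s (z s)) μ := by
  obtain ⟨z', hz', hzz⟩ := hz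
  -- On each level set of a simple function the second argument is frozen, so `hm` applies. A
  -- general argument is a pointwise limit of simple ones, and continuity of `Ψ s` passes to that
  -- limit.
  have key : ∀ φ : SimpleFunc S E, AEStronglyMeasurable (fun s => Ψ s (φ s)) μ := by
    intro φ
    have hcov : (⋃ c : φ.range, φ ⁻¹' {(c : E)}) = univ := by
      ext s
      simp
    rw [← Measure.restrict_univ (μ := μ), ← hcov, aestronglyMeasurable_iUnion_iff]
    intro c
    refine (hm c).restrict.congr ?_
    filter_upwards [ae_restrict_mem (φ.measurableSet_preimage {(c : E)})] with s hs
    rw [mem_preimage, mem_singleton_iff] at hs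
    rw [hs]
  have hlim : AEStronglyMeasurable (fun s => Ψ s (z' s)) μ := by
    refine aestronglyMeasurable_of_tendsto_ae atTop (fun n => key (hz'.approx n)) ?_
    filter_upwards [hc] with s hs
    exact (hs.tendsto _).comp (hz'.tendsto_approx s)
  refine hlim.congr ?_
  filter_upwards [hzz] with s hs
  rw [hs]

/-! ### Superposition operators on `L²` -/

section Superposition

variable {Ω : Type*} [MeasurableSpace Ω] {P : Measure Ω}
  {E F : Type*} [NormedAddCommGroup E] [NormedAddCommGroup F]

theorem continuous_of_norm_sub_le {ψ : E → F} {K : ℝ}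
    (hψ : ∀ x y, ‖ψ x - ψ y‖ ≤ K * ‖x - y‖) : Continuous ψ :=
  (LipschitzWith.of_dist_le' (K := K) fun x y => by
    simpa [dist_eq_norm] using hψ x y).continuous

theorem memLp_comp_of_norm_sub_le [IsFiniteMeasure P] {ψ : E → F} {K : ℝ}
    (hψ : ∀ x y, ‖ψ x - ψ y‖ ≤ K * ‖x - y‖) (y : Lp E 2 P) :
    MemLp (fun ω => ψ (y ω)) 2 P := by
  have hm : AEStronglyMeasurable (fun ω => ψ (y ω)) P :=
    (continuous_of_norm_sub_le hψ).comp_aestronglyMeasurable (Lp.aestronglyMeasurable y)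
  have h1 : MemLp (fun ω => ψ (y ω) - ψ 0) 2 P := by
    refine (Lp.memLp y).of_le_mul (c := K) (hm.sub aestronglyMeasurable_const) ?_
    filter_upwards with ω
    simpa using hψ (y ω) 0
  convert h1.add (memLp_const (ψ 0)) using 1
  ext ω
  simp

open Classical in
/-- The superposition operator `y ↦ ψ ∘ y` on `L²`, with value `0` if `ψ ∘ y` is not in `L²`. -/
noncomputable def superposition (P : Measure Ω) (ψ : E → F) (y : Lp E 2 P) : Lp F 2 P :=
  if h : MemLp (fun ω => ψ (y ω)) 2 P then h.toLp _ else 0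

theorem coeFn_superposition [IsFiniteMeasure P] {ψ : E → F} {K : ℝ}
    (hψ : ∀ x y, ‖ψ x - ψ y‖ ≤ K * ‖x - y‖) (y : Lp E 2 P) :
    superposition P ψ y =ᵐ[P] fun ω => ψ (y ω) := by
  have h := memLp_comp_of_norm_sub_le hψ y
  rw [superposition, dif_pos h]
  exact h.coeFn_toLp

theorem norm_superposition_sub_le [IsFiniteMeasure P] {ψ : E → F} {K : ℝ}
    (hψ : ∀ x y, ‖ψ x - ψ y‖ ≤ K * ‖x - y‖) (y z : Lp E 2 P) :
    ‖superposition P ψ y - superposition P ψ z‖ ≤ K * ‖y - z‖ := by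
  refine Lp.norm_le_mul_norm_of_ae_le_mul ?_
  filter_upwards [coeFn_superposition hψ y, coeFn_superposition hψ z,
    Lp.coeFn_sub (superposition P ψ y) (superposition P ψ z), Lp.coeFn_sub y z] with ω h1 h2 h3 h4
  rw [h3, h4, Pi.sub_apply, Pi.sub_apply, h1, h2]
  exact hψ _ _

theorem norm_superposition_zero_le [IsProbabilityMeasure P] {ψ : E → F} {K C : ℝ}
    (hψ : ∀ x y, ‖ψ x - ψ y‖ ≤ K * ‖x - y‖) (hC : 0 ≤ C) (h0 : ‖ψ 0‖ ≤ C) :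
    ‖superposition P ψ 0‖ ≤ C := by
  have := Lp.norm_le_of_ae_bound (f := superposition P ψ 0) hC (by
    filter_upwards [coeFn_superposition hψ (0 : Lp E 2 P), Lp.coeFn_zero E 2 P] with ω h1 h2
    rw [h1, h2]
    exact h0)
  simpa [measureUnivNNReal] using this

/-- Density of simple functions of `ω` reduces the claim to constants `c`: `ψ ∘ (1_B c)` is `1_B
ψ(c) + 1_{Bᶜ} ψ(0)`, and the common Lipschitz constant handles limits. -/
theorem aestronglyMeasurable_superposition [IsFiniteMeasure P] {S : Type*} [MeasurableSpace S]
    {μ : Measure S} {Ψ : S → E → F} {K : ℝ} (hΨ : ∀ s, ∀ x y, ‖Ψ s x - Ψ s y‖ ≤ K * ‖x - y‖)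
    (hm : ∀ c, AEStronglyMeasurable (fun s => Ψ s c) μ) (y : Lp E 2 P) :
    AEStronglyMeasurable (fun s => superposition P (Ψ s) y) μ := by
  have hcst : ∀ (B : Set Ω) (hB : MeasurableSet B) (c : E), AEStronglyMeasurable
      (fun s => indicatorConstLp 2 hB (measure_ne_top P B) (Ψ s c)) μ := by
    intro B hB c
    have hcont : Continuous fun d : F => indicatorConstLp (μ := P) 2 hB (measure_ne_top P B) d := by
      refine continuous_of_norm_sub_le (K := P.real B ^ (1 / (2 : ℝ≥0∞).toReal)) fun d e => ?_
      rw [indicatorConstLp_sub, mul_comm]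
      exact norm_indicatorConstLp_le
    exact hcont.comp_aestronglyMeasurable (hm c)
  induction y using Lp.induction (ENNReal.ofNat_ne_top (n := 2)) with
  | indicatorConst c hs hμs =>
    rename_i B
    refine ((hcst B hs c).add (hcst Bᶜ hs.compl 0)).congr (ae_of_all _ fun s => ?_)
    refine Lp.ext ?_
    simp only [Pi.add_apply]
    filter_upwards [coeFn_superposition (hΨ s)
        ((Lp.simpleFunc.indicatorConst 2 hs hμs.ne c : Lp.simpleFunc E 2 P) : Lp E 2 P),
      Lp.coeFn_add (indicatorConstLp 2 hs (measure_ne_top P B) (Ψ s c))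
        (indicatorConstLp 2 hs.compl (measure_ne_top P Bᶜ) (Ψ s 0)),
      indicatorConstLp_coeFn (p := 2) (hs := hs) (hμs := measure_ne_top P B) (c := Ψ s c),
      indicatorConstLp_coeFn (p := 2) (hs := hs.compl) (hμs := measure_ne_top P Bᶜ) (c := Ψ s 0),
      indicatorConstLp_coeFn (p := 2) (hs := hs) (hμs := measure_ne_top P B) (c := c)]
      with ω h1 h2 h3 h4 h5
    rw [h1, h2, Pi.add_apply, h3, h4, Lp.simpleFunc.coe_indicatorConst, h5]
    by_cases hω : ω ∈ B <;> simp [hω]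
  | add hf hg hfg hf' hg' =>
    rename_i u v
    have h0 := hcst univ MeasurableSet.univ 0
    -- Superposition is not additive, but for `u`, `v` with disjoint supports `ψ(u + v) = ψ(u) +
    -- ψ(v) - ψ(0)`.
    refine ((hf'.add hg').sub h0).congr (ae_of_all _ fun s => ?_)
    refine Lp.ext ?_
    simp only [Pi.add_apply, Pi.sub_apply]
    filter_upwards [coeFn_superposition (hΨ s) (hf.toLp u), coeFn_superposition (hΨ s) (hg.toLp v),
      coeFn_superposition (hΨ s) (hf.toLp u + hg.toLp v), Lp.coeFn_add (hf.toLp u) (hg.toLp v),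
      hf.coeFn_toLp, hg.coeFn_toLp,
      Lp.coeFn_sub (superposition P (Ψ s) (hf.toLp u) + superposition P (Ψ s) (hg.toLp v))
        (indicatorConstLp 2 MeasurableSet.univ (measure_ne_top P univ) (Ψ s 0)),
      Lp.coeFn_add (superposition P (Ψ s) (hf.toLp u)) (superposition P (Ψ s) (hg.toLp v)),
      indicatorConstLp_coeFn (p := 2) (hs := MeasurableSet.univ) (hμs := measure_ne_top P univ)
        (c := Ψ s 0)] with ω h1 h2 h3 h4 h5 h6 h7 h8 h9
    rw [h7, Pi.sub_apply, h8, Pi.add_apply, h1, h2, h3, h4, Pi.add_apply, h9, h5, h6]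
    simp only [indicator_univ]
    by_cases hω : u ω = 0
    · simp [hω]
    · have : v ω = 0 := by
        by_contra h
        exact Set.disjoint_left.1 hfg hω h
      simp [this]
  | isClosed =>
    refine IsSeqClosed.isClosed fun u y hu huy => ?_
    refine aestronglyMeasurable_of_tendsto_ae atTop (fun n => hu n) (ae_of_all _ fun s => ?_)
    exact ((continuous_of_norm_sub_le (norm_superposition_sub_le (P := P) (hΨ s))).tendsto y).comp
      huy

end Superposition

/-! ### Strongly continuous families of operators acting on `L²` -/

section CompLp

variable {Ω : Type*} [MeasurableSpace Ω] {P : Measure Ω}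
  {E F : Type*} [NormedAddCommGroup E] [NormedSpace ℝ E] [NormedAddCommGroup F] [NormedSpace ℝ F]

/-- The uniform bound on `‖L a‖` turns `u n → x` into uniform convergence of the orbits. Strong
continuity thus needs checking only on a dense set. -/
theorem isClosed_setOf_continuousOn_apply {α : Type*} [TopologicalSpace α] {s : Set α}
    {L : α → E →L[ℝ] F} {M : ℝ} (hL : ∀ a ∈ s, ‖L a‖ ≤ M) :
    IsClosed {x : E | ContinuousOn (fun a => L a x) s} := by
  refine IsSeqClosed.isClosed fun u x hu hux => ?_
  refine TendstoUniformlyOn.continuousOn (p := atTop) (F := fun n a => L a (u n)) ?_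
    (Frequently.of_forall hu)
  rw [Metric.tendstoUniformlyOn_iff]
  intro ε hε
  have hlim : Tendsto (fun n => M * ‖x - u n‖) atTop (𝓝 0) := by
    have := (tendsto_const_nhds (x := x)).sub hux
    simpa using this.norm.const_mul M
  filter_upwards [hlim.eventually_lt_const hε] with n hn a ha
  rw [dist_eq_norm, ← map_sub]
  exact (((L a).le_opNorm _).trans (by gcongr; exact hL a ha)).trans_lt hn

theorem continuousOn_compLp [IsFiniteMeasure P] {α : Type*} [TopologicalSpace α] {s : Set α}
    {L : α → E →L[ℝ] F} {M : ℝ} (hL : ∀ a ∈ s, ‖L a‖ ≤ M)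
    (hc : ∀ x, ContinuousOn (fun a => L a x) s) (y : Lp E 2 P) :
    ContinuousOn (fun a => (L a).compLp y) s := by
  have hcl := isClosed_setOf_continuousOn_apply (L := fun a => (L a).compLpL 2 P) (s := s) (M := M)
    fun a ha => (ContinuousLinearMap.norm_compLpL_le (L a)).trans (hL a ha)
  change ContinuousOn (fun a => (L a).compLpL 2 P y) s
  induction y using Lp.induction (ENNReal.ofNat_ne_top (n := 2)) with
  | indicatorConst c hs hμs =>
    rename_i B
    have hcont : Continuous fun d : F => indicatorConstLp (μ := P) 2 hs (measure_ne_top P B) d := by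
      refine continuous_of_norm_sub_le (K := P.real B ^ (1 / (2 : ℝ≥0∞).toReal)) fun d e => ?_
      rw [indicatorConstLp_sub, mul_comm]
      exact norm_indicatorConstLp_le
    refine (hcont.comp_continuousOn (hc c)).congr fun a ha => ?_
    refine Lp.ext ?_
    filter_upwards [ContinuousLinearMap.coeFn_compLpL (L a)
        ((Lp.simpleFunc.indicatorConst 2 hs hμs.ne c : Lp.simpleFunc E 2 P) : Lp E 2 P),
      indicatorConstLp_coeFn (p := 2) (hs := hs) (hμs := measure_ne_top P B) (c := c),
      indicatorConstLp_coeFn (p := 2) (hs := hs) (hμs := measure_ne_top P B) (c := L a c)]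
      with ω h1 h2 h3
    rw [h1, Lp.simpleFunc.coe_indicatorConst, h2]
    simp only [Function.comp_def]
    rw [h3]
    by_cases hω : ω ∈ B <;> simp [hω]
  | add hf hg _ hf' hg' =>
    simp only [map_add]
    exact hf'.add hg'
  | isClosed => exact hcl

end CompLp

/-! ### A weighted contraction principle -/

/-- This is Banach's fixed point theorem for the norm `sup exp (-l t) ‖x t‖`. Comparing with an
arbitrary `D * exp (l s)` expresses the weighted distance without building the function space;
Picard iterates then converge geometrically and uniformly. -/
theorem exists_unique_of_weighted_contraction {E : Type*} [NormedAddCommGroup E] [NormedSpace ℝ E]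
    [CompleteSpace E] {a T : ℝ} (hT : 0 ≤ T) (φ : ℝ → E) (hφ : ContinuousOn φ (Icc a 0)) (ha : a ≤ 0)
    (Γ : (ℝ → E) → ℝ → E) (κ l : ℝ) (hκ0 : 0 ≤ κ) (hκ : κ < 1)
    (hcont : ∀ x, ContinuousOn x (Icc a T) → (∀ t ∈ Icc a 0, x t = φ t) →
      ContinuousOn (Γ x) (Icc a T) ∧ ∀ t ∈ Icc a 0, Γ x t = φ t)
    (hcontr : ∀ x y, ContinuousOn x (Icc a T) → (∀ t ∈ Icc a 0, x t = φ t) →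
      ContinuousOn y (Icc a T) → (∀ t ∈ Icc a 0, y t = φ t) → ∀ D,
      (∀ s ∈ Icc a T, ‖x s - y s‖ ≤ D * Real.exp (l * s)) →
      ∀ t ∈ Icc a T, ‖Γ x t - Γ y t‖ ≤ κ * D * Real.exp (l * t)) :
    ∃ x, (ContinuousOn x (Icc a T) ∧ (∀ t ∈ Icc a 0, x t = φ t) ∧ ∀ t ∈ Icc a T, Γ x t = x t) ∧
      ∀ y, ContinuousOn y (Icc a T) → (∀ t ∈ Icc a 0, y t = φ t) →
        (∀ t ∈ Icc a T, Γ y t = y t) → ∀ t ∈ Icc a T, y t = x t := by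
  have hbound : ∀ x y : ℝ → E, ContinuousOn x (Icc a T) → ContinuousOn y (Icc a T) →
      ∃ D, ∀ s ∈ Icc a T, ‖x s - y s‖ ≤ D * Real.exp (l * s) := by
    intro x y hx hy
    have hc : ContinuousOn (fun s => Real.exp (-(l * s)) • (x s - y s)) (Icc a T) :=
      ContinuousOn.smul (by fun_prop) (hx.sub hy)
    obtain ⟨D, hD⟩ := isCompact_Icc.exists_bound_of_continuousOn hc
    refine ⟨D, fun s hs => ?_⟩
    have h := hD s hs
    rw [norm_smul, Real.norm_of_nonneg (Real.exp_pos _).le, Real.exp_neg] at h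
    rwa [inv_mul_le_iff₀ (Real.exp_pos _), mul_comm] at h
  have hzero : ∀ D t : ℝ, Tendsto (fun n : ℕ => κ ^ n * D * Real.exp (l * t)) atTop (𝓝 0) := by
    intro D t
    have := ((tendsto_pow_atTop_nhds_zero_of_lt_one hκ0 hκ).mul_const D).mul_const (Real.exp (l * t))
    simpa using this
  -- The starting point extends `φ` to positive times by the constant `φ 0`.
  let X : ℕ → ℝ → E := fun n => Γ^[n] fun t => φ (min t 0)
  have hX0 : ContinuousOn (X 0) (Icc a T) ∧ ∀ t ∈ Icc a 0, X 0 t = φ t := by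
    refine ⟨hφ.comp (by fun_prop) fun t ht => ⟨le_min ht.1 ha, min_le_right _ _⟩, fun t ht => ?_⟩
    simp [X, min_eq_left ht.2]
  have hXs : ∀ n, X (n + 1) = Γ (X n) := fun n => Function.iterate_succ_apply' _ _ _
  have hX : ∀ n, ContinuousOn (X n) (Icc a T) ∧ ∀ t ∈ Icc a 0, X n t = φ t := by
    intro n
    induction n with
    | zero => exact hX0
    | succ n ih => rw [hXs]; exact hcont _ ih.1 ih.2
  obtain ⟨D, hD⟩ := hbound (X 0) (X 1) (hX 0).1 (hX 1).1
  have hgeo : ∀ n, ∀ t ∈ Icc a T, ‖X n t - X (n + 1) t‖ ≤ κ ^ n * D * Real.exp (l * t) := by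
    intro n
    induction n with
    | zero => simpa using hD
    | succ n ih =>
      intro t ht
      rw [hXs n, hXs (n + 1), pow_succ' κ n, mul_assoc κ]
      exact hcontr _ _ (hX n).1 (hX n).2 (hX (n + 1)).1 (hX (n + 1)).2 _ ih t ht
  have hlim : ∀ t : ℝ, ∃ z, t ∈ Icc a T → Tendsto (fun n => X n t) atTop (𝓝 z) := by
    intro t
    by_cases ht : t ∈ Icc a T
    · obtain ⟨z, hz⟩ := cauchySeq_tendsto_of_complete
        (cauchySeq_of_le_geometric (f := fun n => X n t) κ (D * Real.exp (l * t)) hκ fun n => by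
          rw [dist_eq_norm]; linarith [hgeo n t ht])
      exact ⟨z, fun _ => hz⟩
    · exact ⟨0, fun h => absurd h ht⟩
  choose x hx using hlim
  have hrate : ∀ n, ∀ t ∈ Icc a T,
      ‖X n t - x t‖ ≤ (κ ^ n * (D / (1 - κ))) * Real.exp (l * t) := by
    intro n t ht
    have := dist_le_of_le_geometric_of_tendsto (f := fun n => X n t) κ (D * Real.exp (l * t)) hκ
      (fun n => by rw [dist_eq_norm]; linarith [hgeo n t ht]) (hx t ht) n
    rw [dist_eq_norm] at this
    refine this.trans_eq ?_
    ring
  have hxc : ContinuousOn x (Icc a T) := by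
    refine TendstoUniformlyOn.continuousOn (p := atTop) (F := X) ?_
      (Frequently.of_forall fun n => (hX n).1)
    obtain ⟨C, hC⟩ := isCompact_Icc.exists_bound_of_continuousOn
      (s := Icc a T) (f := fun s => Real.exp (l * s)) (by fun_prop)
    rw [Metric.tendstoUniformlyOn_iff]
    intro ε hε
    have h0 : Tendsto (fun n : ℕ => κ ^ n * (|D| / (1 - κ)) * C) atTop (𝓝 0) := by
      simpa using ((tendsto_pow_atTop_nhds_zero_of_lt_one hκ0 hκ).mul_const
        (|D| / (1 - κ))).mul_const C
    filter_upwards [h0.eventually_lt_const hε] with n hn t ht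
    rw [dist_comm, dist_eq_norm]
    refine (hrate n t ht).trans_lt (lt_of_le_of_lt ?_ hn)
    have h1 : 0 < 1 - κ := by linarith
    have h2 := hC t ht
    rw [Real.norm_of_nonneg (Real.exp_pos _).le] at h2
    gcongr
    exact le_abs_self D
  have hxφ : ∀ t ∈ Icc a 0, x t = φ t := by
    intro t ht
    refine tendsto_nhds_unique (hx t ⟨ht.1, ht.2.trans hT⟩) ?_
    simp [(hX _).2 t ht]
  have hxfix : ∀ t ∈ Icc a T, Γ x t = x t := by
    intro t ht
    refine tendsto_nhds_unique (f := fun n => X (n + 1) t) ?_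
      ((tendsto_add_atTop_iff_nat 1).2 (hx t ht))
    rw [tendsto_iff_norm_sub_tendsto_zero]
    refine squeeze_zero (fun n => norm_nonneg _) (fun n => ?_)
      (by simpa using (hzero (D / (1 - κ)) t).const_mul κ)
    rw [hXs]
    exact (hcontr _ _ (hX n).1 (hX n).2 hxc hxφ _ (hrate n) t ht).trans_eq (by ring)
  refine ⟨x, ⟨hxc, hxφ, hxfix⟩, fun y hy hyφ hfix t ht => ?_⟩
  obtain ⟨D, hD⟩ := hbound y x hy hxc
  have hn : ∀ n : ℕ, ∀ t ∈ Icc a T, ‖y t - x t‖ ≤ κ ^ n * D * Real.exp (l * t) := by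
    intro n
    induction n with
    | zero => simpa using hD
    | succ n ih =>
      intro t ht
      have h := hcontr _ _ hy hyφ hxc hxφ _ ih t ht
      rw [hfix t ht, hxfix t ht] at h
      rw [pow_succ' κ n, mul_assoc κ]
      exact h
  have h := ge_of_tendsto' (hzero D t) fun n => hn n t ht
  exact sub_eq_zero.1 (norm_le_zero_iff.1 h)

/-! ### Measurability along an evolution family -/

section EvolutionMeasurability

variable {X : Type*} [NormedAddCommGroup X] [NormedSpace ℝ X]
  {T : ℝ} {A : ℝ → X →ₗ.[ℝ] X} {U : ℝ → ℝ → X →L[ℝ] X}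

theorem IsEvolutionFamily.continuousOn_right (hU : IsEvolutionFamily T U) {t : ℝ}
    (ht : t ∈ Icc 0 T) (x : X) : ContinuousOn (fun s => U t s x) (Icc 0 t) :=
  (hU.strongly_continuous x).comp (f := fun s => (t, s)) (by fun_prop)
    fun _ hs => ⟨hs.1, hs.2, ht.2⟩

theorem IsEvolutionFamily.aestronglyMeasurable_apply (hU : IsEvolutionFamily T U) {t : ℝ}
    (ht : t ∈ Icc 0 T) {z : ℝ → X} (hz : AEStronglyMeasurable z (volume.restrict (Icc 0 t))) :
    AEStronglyMeasurable (fun s => U t s (z s)) (volume.restrict (Icc 0 t)) :=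
  aestronglyMeasurable_apply_of_continuous (Ψ := fun s x => U t s x)
    (ae_of_all _ fun s => (U t s).continuous)
    (fun y => (hU.continuousOn_right ht y).aestronglyMeasurable measurableSet_Icc) hz

/-- The indicator may jump only at `s = t₀`, a null set of times; this is the pointwise input to
dominated convergence for integrals with a moving end point. -/
theorem IsEvolutionFamily.tendsto_indicator_apply (hV : IsEvolutionFamily T U) {s t₀ : ℝ}
    (hs : s ∈ Icc 0 T) (ht₀ : t₀ ∈ Icc 0 T) (hst : s ≠ t₀) (h : ℝ → X) :
    Tendsto (fun t => (Icc 0 t).indicator (fun s => U t s (h s)) s) (𝓝[Icc 0 T] t₀)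
      (𝓝 ((Icc 0 t₀).indicator (fun s => U t₀ s (h s)) s)) := by
  rcases lt_or_gt_of_ne hst with hlt | hlt
  · have hc : ContinuousWithinAt (fun t => U t s (h s)) (Icc s T) t₀ :=
      ((hV.strongly_continuous (h s)).comp (f := fun t => (t, s))
        (by fun_prop) fun t ht => ⟨hs.1, ht.1, ht.2⟩) t₀ ⟨hlt.le, ht₀.2⟩
    have hnhds : 𝓝[Icc 0 T] t₀ ≤ 𝓝[Icc s T] t₀ := by
      refine nhdsWithin_le_iff.2 ?_
      filter_upwards [self_mem_nhdsWithin, mem_nhdsWithin_of_mem_nhds (Ioi_mem_nhds hlt)]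
        with t ht h1
      exact ⟨le_of_lt h1, ht.2⟩
    rw [indicator_of_mem (show s ∈ Icc 0 t₀ from ⟨hs.1, hlt.le⟩)]
    refine (hc.mono_left hnhds).congr' ?_
    filter_upwards [mem_nhdsWithin_of_mem_nhds (Ioi_mem_nhds hlt)] with t h1
    rw [indicator_of_mem (show s ∈ Icc 0 t from ⟨hs.1, le_of_lt h1⟩)]
  · rw [indicator_of_notMem (fun hmem => absurd hmem.2 (not_le.2 hlt))]
    refine tendsto_const_nhds.congr' ?_
    filter_upwards [mem_nhdsWithin_of_mem_nhds (Iio_mem_nhds hlt)] with t h1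
    rw [indicator_of_notMem (fun hmem => absurd hmem.2 (not_le.2 h1))]

theorem aestronglyMeasurable_of_hasDerivWithinAt_Ici {F : Type*} [NormedAddCommGroup F]
    [NormedSpace ℝ F] {t : ℝ} {u u' : ℝ → F} (hu : ContinuousOn u (Icc 0 t))
    (hd : ∀ s ∈ Ico 0 t, HasDerivWithinAt u (u' s) (Icc s t) s) :
    AEStronglyMeasurable u' (volume.restrict (Icc 0 t)) := by
  rcases lt_or_ge t 0 with ht | ht
  · simp [Icc_eq_empty_of_lt ht]
  -- Clamping the time to `[0,t]` makes the difference quotients continuous on the whole line; `u'`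
  -- is their almost everywhere limit along the steps `1 / (n + 1)`.
  let v : ℝ → F := fun s => u (max 0 (min s t))
  have hv : Continuous v := by
    rw [← continuousOn_univ]
    exact hu.comp (by fun_prop) fun s _ => ⟨le_max_left _ _, max_le ht (min_le_right _ _)⟩
  have hvu : ∀ s ∈ Icc 0 t, v s = u s := fun s hs => by
    simp [v, min_eq_left hs.2, max_eq_right hs.1]
  have hseq : ∀ n : ℕ, Continuous fun s : ℝ =>
      ((n : ℝ) + 1) • (v (s + ((n : ℝ) + 1)⁻¹) - v s) := fun n => by fun_prop
  refine aestronglyMeasurable_of_tendsto_ae atTop (fun n => (hseq n).aestronglyMeasurable) ?_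
  have hne : ∀ᵐ s ∂volume.restrict (Icc 0 t), s ≠ t :=
    ae_restrict_of_ae (by simp [ae_iff])
  filter_upwards [ae_restrict_mem measurableSet_Icc, hne] with s hs hst
  have hlt : s < t := lt_of_le_of_ne hs.2 hst
  have h := hasDerivWithinAt_iff_tendsto_slope.1 (hd s ⟨hs.1, hlt⟩)
  have h0 : Tendsto (fun n : ℕ => ((n : ℝ) + 1)⁻¹) atTop (𝓝 0) := by
    simpa using tendsto_one_div_add_atTop_nhds_zero_nat (𝕜 := ℝ)
  have hpos : ∀ n : ℕ, 0 < ((n : ℝ) + 1)⁻¹ := fun n => by positivity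
  have hev : ∀ᶠ n : ℕ in atTop, ((n : ℝ) + 1)⁻¹ < t - s :=
    h0.eventually_lt_const (by linarith)
  have hw : Tendsto (fun n : ℕ => s + ((n : ℝ) + 1)⁻¹) atTop (𝓝[Icc s t \ {s}] s) := by
    refine tendsto_nhdsWithin_iff.2 ⟨by simpa using h0.const_add s, ?_⟩
    filter_upwards [hev] with n hn
    exact ⟨⟨by linarith [hpos n], by linarith⟩, by simpa using (hpos n).ne'⟩
  refine (h.comp hw).congr' ?_
  filter_upwards [hev] with n hn
  rw [hvu s hs, hvu _ ⟨by linarith [hpos n, hs.1], by linarith⟩]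
  simp [slope]

/-- For a continuous `h` with values in the domains, `s ↦ U(t,s) A(s) h(s)` is measurable:
`A(0) h` is measurable since the injective map `A(0)⁻¹` is a measurable embedding, and the bounded
operators `U(t,s) A(s) A(0)⁻¹` are right derivatives of continuous functions. -/
theorem Generates.aestronglyMeasurable_apply_generator [CompleteSpace X]
    [TopologicalSpace.SeparableSpace X] (hAU : Generates T A U) {R : X →L[ℝ] X}
    (hR : IsInverse (A 0) R) {h w : ℝ → X} (hh : ContinuousOn h (Icc 0 T))
    (hw : ∀ s ∈ Icc 0 T, ∃ hs : h s ∈ (A s).domain, A s ⟨h s, hs⟩ = w s) {t : ℝ}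
    (ht : t ∈ Icc 0 T) :
    AEStronglyMeasurable (fun s => U t s (w s)) (volume.restrict (Icc 0 t)) := by
  have hT : (0 : ℝ) ∈ Icc 0 T := ⟨le_rfl, ht.1.trans ht.2⟩
  have hdom : ∀ s ∈ Icc 0 T, ∀ y, R y ∈ (A s).domain := fun s hs y => by
    rw [hAU.domain_eq s hs 0 hT]
    exact (hR.1 y).choose
  have hRinj : Function.Injective R := by
    intro y z hyz
    obtain ⟨h1, h2⟩ := hR.1 y
    obtain ⟨h3, h4⟩ := hR.1 z
    rw [← h2, ← h4]
    congr 2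
  classical
  let v : ℝ → X := fun s => if hs : s ∈ Icc 0 T then
    A 0 ⟨h s, by rw [hAU.domain_eq 0 hT s hs]; exact (hw s hs).choose⟩ else 0
  have hRv : R ∘ v = (Icc 0 T).indicator h := by
    ext s
    by_cases hs : s ∈ Icc 0 T
    · simp only [Function.comp_apply, v, dif_pos hs, indicator_of_mem hs]
      exact hR.2 ⟨h s, _⟩
    · simp only [Function.comp_apply, v, dif_neg hs, indicator_of_notMem hs, map_zero]
  -- By the Lusin–Souslin theorem, measurability of `R ∘ v` is equivalent to that of `v`.
  have hv : StronglyMeasurable v := by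
    borelize X
    have := UniformSpace.secondCountable_of_separable X
    have hemb : MeasurableEmbedding R := R.continuous.measurableEmbedding hRinj
    refine Measurable.stronglyMeasurable (hemb.measurable_comp_iff.1 ?_)
    rw [hRv]
    rw [← piecewise_eq_indicator]
    exact hh.measurable_piecewise continuous_zero.continuousOn measurableSet_Icc
  let K : ∀ s ∈ Icc 0 T, X →ₗ[ℝ] X := fun s hs =>
    (A s).toFun.comp (R.toLinearMap.codRestrict (A s).domain (hdom s hs))
  -- Closed graph theorem: `A(s) R` is everywhere defined because the domains coincide, and its
  -- graph is the preimage of a closed set.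
  have hK : ∀ s (hs : s ∈ Icc 0 T), Continuous (K s hs) := by
    intro s hs
    refine LinearMap.continuous_of_isClosed_graph (K s hs) ?_
    have hgr : ((K s hs).graph : Set (X × X)) =
        (fun p : X × X => (R p.1, p.2)) ⁻¹' ((A s).graph : Set (X × X)) := by
      ext ⟨y, z⟩
      simp only [SetLike.mem_coe, LinearMap.mem_graph_iff, mem_preimage, LinearPMap.mem_graph_iff]
      constructor
      · rintro rfl
        exact ⟨⟨R y, hdom s hs y⟩, rfl, rfl⟩
      · rintro ⟨⟨a, ha⟩, h1, h2⟩
        simp only at h1 h2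
        subst h1
        exact h2.symm
    rw [hgr]
    exact (hAU.closed s hs).preimage (by fun_prop)
  have hsT : ∀ {s}, s ∈ Icc 0 t → s ∈ Icc 0 T := fun hs => ⟨hs.1, hs.2.trans ht.2⟩
  let Ψ : ℝ → X → X := fun s y => if hs : s ∈ Icc 0 T then U t s (K s hs y) else 0
  have hΨc : ∀ s, Continuous (Ψ s) := by
    intro s
    by_cases hs : s ∈ Icc 0 T
    · simp only [Ψ, dif_pos hs]
      exact (U t s).continuous.comp (hK s hs)
    · simpa only [Ψ, dif_neg hs] using continuous_const
  have hΨm : ∀ y, AEStronglyMeasurable (fun s => Ψ s y) (volume.restrict (Icc 0 t)) := by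
    intro y
    have h := aestronglyMeasurable_of_hasDerivWithinAt_Ici (t := t) (u' := fun s => -Ψ s y)
      (hAU.evolution.continuousOn_right ht (R y)) fun s hs => by
        have hs' : s ∈ Icc 0 T := hsT ⟨hs.1, hs.2.le⟩
        simp only [Ψ, dif_pos hs']
        exact hAU.deriv_right s t hs.1 hs.2 ht.2 ⟨R y, hdom s hs' y⟩
    simpa only [Pi.neg_def, neg_neg] using h.neg
  refine (aestronglyMeasurable_apply_of_continuous (ae_of_all _ hΨc) hΨm
    hv.aestronglyMeasurable).congr ?_
  filter_upwards [ae_restrict_mem measurableSet_Icc] with s hs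
  obtain ⟨h1, h2⟩ := hw s (hsT hs)
  simp only [Ψ, dif_pos (hsT hs), ← h2]
  congr 1
  have h3 : R (v s) = h s := by
    rw [← Function.comp_apply (f := R) (g := v), hRv, indicator_of_mem (hsT hs)]
  change (A s) ⟨R (v s), _⟩ = _
  congr 2

end EvolutionMeasurability

/-! ### The kernel `|u - v| ^ (2H - 2)` -/

section Kernel

variable {p : ℝ}

theorem abs_rpow_sub_one_mul_self_of_nonneg (hp : 0 < p) {x : ℝ} (hx : 0 ≤ x) :
    |x| ^ (p - 1) * x = x ^ p := by
  rcases hx.eq_or_lt with rfl | hx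
  · simp [Real.zero_rpow hp.ne']
  · rw [abs_of_pos hx, ← Real.rpow_add_one hx.ne']
    congr 1
    ring

theorem abs_rpow_sub_one_mul_self_of_nonpos (hp : 0 < p) {x : ℝ} (hx : x ≤ 0) :
    |x| ^ (p - 1) * x = -(-x) ^ p := by
  have := abs_rpow_sub_one_mul_self_of_nonneg hp (neg_nonneg.2 hx)
  rw [abs_neg] at this
  linarith

theorem continuous_abs_rpow_sub_one_mul_self (hp : 0 < p) :
    Continuous fun x : ℝ => |x| ^ (p - 1) * x := by
  have : (fun x : ℝ => |x| ^ (p - 1) * x) = fun x => (max x 0) ^ p - (max (-x) 0) ^ p := by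
    ext x
    rcases le_total 0 x with hx | hx
    · rw [abs_rpow_sub_one_mul_self_of_nonneg hp hx, max_eq_left hx,
        max_eq_right (neg_nonpos.2 hx), Real.zero_rpow hp.ne', sub_zero]
    · rw [abs_rpow_sub_one_mul_self_of_nonpos hp hx, max_eq_right hx,
        max_eq_left (neg_nonneg.2 hx), Real.zero_rpow hp.ne', zero_sub]
  rw [this]
  exact ((continuous_id.max continuous_const).rpow_const fun _ => Or.inr hp.le).sub
    ((continuous_neg.max continuous_const).rpow_const fun _ => Or.inr hp.le)

theorem hasDerivAt_abs_rpow_sub_one_mul_self (hp : 0 < p) {x : ℝ} (hx : x ≠ 0) :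
    HasDerivAt (fun x : ℝ => |x| ^ (p - 1) * x) (p * |x| ^ (p - 1)) x := by
  rcases hx.lt_or_gt with hx | hx
  · have h := ((hasDerivAt_neg x).rpow_const (p := p) (Or.inl (neg_ne_zero.2 hx.ne))).neg
    rw [abs_of_neg hx]
    refine (h.congr_of_eventuallyEq ?_).congr_deriv (by ring)
    filter_upwards [Iio_mem_nhds hx] with y hy
    exact abs_rpow_sub_one_mul_self_of_nonpos hp (le_of_lt hy)
  · have h := Real.hasDerivAt_rpow_const (p := p) (Or.inl hx.ne')
    rw [abs_of_pos hx]
    refine h.congr_of_eventuallyEq ?_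
    filter_upwards [Ioi_mem_nhds hx] with y hy
    exact abs_rpow_sub_one_mul_self_of_nonneg hp (le_of_lt hy)

theorem intervalIntegrable_abs_rpow_sub_one (hp : 0 < p) (a b : ℝ) :
    IntervalIntegrable (fun x : ℝ => |x| ^ (p - 1)) volume a b := by
  have h0 : ∀ b : ℝ, 0 ≤ b → IntervalIntegrable (fun x : ℝ => |x| ^ (p - 1)) volume 0 b := by
    intro b hb
    refine (intervalIntegral.intervalIntegrable_rpow' (r := p - 1) (by linarith)).congr ?_
    intro x hx
    rw [uIoc_of_le hb] at hx
    simp only [abs_of_pos hx.1]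
  have h1 : ∀ b : ℝ, IntervalIntegrable (fun x : ℝ => |x| ^ (p - 1)) volume 0 b := by
    intro b
    rcases le_total 0 b with hb | hb
    · exact h0 b hb
    · rw [IntervalIntegrable.iff_comp_neg]
      simpa using h0 (-b) (by linarith)
  exact (h1 a).symm.trans (h1 b)

/-- The antiderivative `|x| ^ (p - 1) * x` is continuous across the possible singularity at `0`, and
one exceptional point does not affect the fundamental theorem of calculus. -/
theorem integral_abs_rpow_sub_one (hp : 0 < p) (a b : ℝ) :
    ∫ x in a..b, |x| ^ (p - 1) = (|b| ^ (p - 1) * b - |a| ^ (p - 1) * a) / p := by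
  have h := integral_eq_of_hasDerivAt_off_countable (fun x : ℝ => |x| ^ (p - 1) * x)
    (fun x => p * |x| ^ (p - 1)) (a := a) (b := b) (countable_singleton 0)
    (continuous_abs_rpow_sub_one_mul_self hp).continuousOn
    (fun x hx => hasDerivAt_abs_rpow_sub_one_mul_self hp hx.2)
    ((intervalIntegrable_abs_rpow_sub_one hp a b).const_mul p)
  rw [intervalIntegral.integral_const_mul] at h
  rw [eq_div_iff hp.ne', mul_comm, h]

theorem integral_abs_rpow_sub_one_mul_self (hp : 0 < p) (a b : ℝ) :
    ∫ x in a..b, |x| ^ (p - 1) * x = (|b| ^ (p + 1) - |a| ^ (p + 1)) / (p + 1) := by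
  have h := intervalIntegral.integral_eq_sub_of_hasDerivAt (a := a) (b := b)
    (f := fun x : ℝ => |x| ^ (p + 1)) (f' := fun x => (p + 1) * (|x| ^ (p - 1) * x))
    (fun x _ => by
      have := hasDerivAt_abs_rpow x (p := p + 1) (by linarith)
      refine this.congr_deriv ?_
      rw [mul_assoc]
      ring_nf)
    ((continuous_const.mul (continuous_abs_rpow_sub_one_mul_self hp)).intervalIntegrable _ _)
  rw [intervalIntegral.integral_const_mul] at h
  rw [eq_div_iff (by linarith), mul_comm, h]

theorem intervalIntegrable_abs_sub_rpow_sub_one (hp : 0 < p) (u c d : ℝ) :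
    IntervalIntegrable (fun v : ℝ => |u - v| ^ (p - 1)) volume c d := by
  simpa using (intervalIntegrable_abs_rpow_sub_one hp (u - c) (u - d)).comp_sub_left u

theorem integral_abs_sub_rpow_sub_one (hp : 0 < p) (u c d : ℝ) :
    ∫ v in c..d, |u - v| ^ (p - 1) =
      (|u - c| ^ (p - 1) * (u - c) - |u - d| ^ (p - 1) * (u - d)) / p := by
  rw [intervalIntegral.integral_comp_sub_left (fun x => |x| ^ (p - 1)) u,
    integral_abs_rpow_sub_one hp]

/-- For `p = 2H - 1` the right-hand side is, up to a factor, the second difference of `|·| ^ (2H)`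
that appears in the covariance of two fractional Brownian increments. -/
theorem integral_integral_abs_sub_rpow_sub_one (hp : 0 < p) (a b c d : ℝ) :
    ∫ u in a..b, ∫ v in c..d, |u - v| ^ (p - 1) =
      (|b - c| ^ (p + 1) - |a - c| ^ (p + 1) - |b - d| ^ (p + 1) + |a - d| ^ (p + 1)) /
        (p * (p + 1)) := by
  have hc := continuous_abs_rpow_sub_one_mul_self hp
  have hci : ∀ e, IntervalIntegrable (fun x => |x - e| ^ (p - 1) * (x - e)) volume a b :=
    fun e => (hc.comp (continuous_sub_right e)).intervalIntegrable _ _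
  simp_rw [integral_abs_sub_rpow_sub_one hp]
  rw [intervalIntegral.integral_div, intervalIntegral.integral_sub
    (hci c) (hci d),
    intervalIntegral.integral_comp_sub_right (fun x => |x| ^ (p - 1) * x) c,
    intervalIntegral.integral_comp_sub_right (fun x => |x| ^ (p - 1) * x) d,
    integral_abs_rpow_sub_one_mul_self hp, integral_abs_rpow_sub_one_mul_self hp]
  field_simp
  ring

theorem lintegral_abs_sub_rpow_sub_one_le (hp : 0 < p) {T u : ℝ} (hu : u ∈ Icc 0 T) :
    ∫⁻ v in Icc 0 T, ENNReal.ofReal (|u - v| ^ (p - 1)) ≤ ENNReal.ofReal (2 * T ^ p / p) := by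
  have h0T : 0 ≤ T := hu.1.trans hu.2
  rw [← Measure.restrict_congr_set Ioc_ae_eq_Icc, ← ofReal_integral_eq_lintegral_ofReal
    ((intervalIntegrable_iff_integrableOn_Ioc_of_le h0T).1
      (intervalIntegrable_abs_sub_rpow_sub_one hp u 0 T))
    (ae_of_all _ fun v => Real.rpow_nonneg (abs_nonneg _) _),
    ← intervalIntegral.integral_of_le h0T, integral_abs_sub_rpow_sub_one hp]
  refine ENNReal.ofReal_le_ofReal ?_
  rw [sub_zero, abs_rpow_sub_one_mul_self_of_nonneg hp hu.1,
    abs_rpow_sub_one_mul_self_of_nonpos hp (sub_nonpos.2 hu.2)]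
  have h1 : u ^ p ≤ T ^ p := Real.rpow_le_rpow hu.1 hu.2 hp.le
  have h2 : (-(u - T)) ^ p ≤ T ^ p :=
    Real.rpow_le_rpow (by linarith [hu.2]) (by linarith [hu.1]) hp.le
  gcongr
  linarith

theorem measurable_abs_sub_rpow (q : ℝ) : Measurable fun z : ℝ × ℝ => |z.1 - z.2| ^ q := by
  fun_prop

theorem integrable_abs_sub_rpow_sub_one (hp : 0 < p) (T : ℝ) :
    Integrable (fun z : ℝ × ℝ => |z.1 - z.2| ^ (p - 1))
      ((volume.restrict (Icc 0 T)).prod (volume.restrict (Icc 0 T))) := by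
  refine ⟨(measurable_abs_sub_rpow _).aestronglyMeasurable, ?_⟩
  rw [hasFiniteIntegral_iff_ofReal (ae_of_all _ fun z => Real.rpow_nonneg (abs_nonneg _) _),
    lintegral_prod _ (by fun_prop)]
  calc ∫⁻ u in Icc 0 T, ∫⁻ v in Icc 0 T, ENNReal.ofReal (|u - v| ^ (p - 1))
      ≤ ∫⁻ u in Icc 0 T, ENNReal.ofReal (2 * T ^ p / p) :=
        setLIntegral_mono' measurableSet_Icc fun u hu => lintegral_abs_sub_rpow_sub_one_le hp hu
    _ < ∞ := by simp [ENNReal.mul_lt_top]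

end Kernel

/-! ### Elementary integrals with respect to fractional Brownian motion -/

section Elementary

variable {Ω : Type*} [MeasurableSpace Ω] {P : Measure Ω} {H T : ℝ} {β : ℝ → Ω → ℝ}

theorem IsFBM.memLp (hβ : IsFBM H T P β) {t : ℝ} (ht : t ∈ Icc 0 T) : MemLp (β t) 2 P :=
  (hβ.gaussian.hasGaussianLaw_eval ⟨t, ht⟩).memLp_two

/-- Expanding the product, the one-variable powers in the covariance cancel. The constant fits
because `H (2H - 1) / ((2H - 1) 2H) = 1 / 2`. -/
theorem IsFBM.integral_increment_mul (hH : H ∈ Ioo (1 / 2 : ℝ) 1) (hβ : IsFBM H T P β)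
    {a b c d : ℝ} (ha : a ∈ Icc 0 T) (hb : b ∈ Icc 0 T) (hc : c ∈ Icc 0 T) (hd : d ∈ Icc 0 T) :
    ∫ ω, (β b ω - β a ω) * (β d ω - β c ω) ∂P =
      H * (2 * H - 1) * ∫ u in a..b, ∫ v in c..d, |u - v| ^ (2 * H - 2) := by
  have hp : 0 < 2 * H - 1 := by linarith [hH.1]
  have h := integral_integral_abs_sub_rpow_sub_one hp a b c d
  rw [show 2 * H - 1 - 1 = 2 * H - 2 by ring, show 2 * H - 1 + 1 = 2 * H by ring] at h
  have hi : ∀ {s t}, s ∈ Icc 0 T → t ∈ Icc 0 T → Integrable (fun ω => β s ω * β t ω) P :=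
    fun hs ht => (hβ.memLp hs).integrable_mul (hβ.memLp ht)
  have he : ∀ ω, (β b ω - β a ω) * (β d ω - β c ω) =
      β b ω * β d ω - β b ω * β c ω - (β a ω * β d ω - β a ω * β c ω) := fun ω => by ring
  simp_rw [he]
  have hs : ∀ {s t u}, s ∈ Icc 0 T → t ∈ Icc 0 T → u ∈ Icc 0 T →
      Integrable (fun ω => β s ω * β t ω - β s ω * β u ω) P :=
    fun hs ht hu => (hi hs ht).sub (hi hs hu)
  rw [integral_sub (hs hb hd hc) (hs ha hd hc),
    integral_sub (hi hb hd) (hi hb hc), integral_sub (hi ha hd) (hi ha hc),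
    hβ.covariance b hb d hd, hβ.covariance b hb c hc, hβ.covariance a ha d hd,
    hβ.covariance a ha c hc, h]
  have hH0 : H ≠ 0 := by linarith [hH.1]
  field_simp
  ring

/-- Using one fixed measure on `[0,T]²` lets the contributions of all pairs of steps be summed under
a single integral. -/
theorem IsFBM.integral_increment_mul_eq_prod (hH : H ∈ Ioo (1 / 2 : ℝ) 1) (hβ : IsFBM H T P β)
    {a b c d : ℝ} (ha : 0 ≤ a) (hab : a ≤ b) (hb : b ≤ T) (hc : 0 ≤ c) (hcd : c ≤ d)
    (hd : d ≤ T) :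
    ∫ ω, (β b ω - β a ω) * (β d ω - β c ω) ∂P =
      H * (2 * H - 1) * ∫ z in Ioc a b ×ˢ Ioc c d, |z.1 - z.2| ^ (2 * H - 2)
        ∂((volume.restrict (Icc 0 T)).prod (volume.restrict (Icc 0 T))) := by
  have hp : 0 < 2 * H - 1 := by linarith [hH.1]
  rw [hβ.integral_increment_mul hH ⟨ha, hab.trans hb⟩ ⟨ha.trans hab, hb⟩ ⟨hc, hcd.trans hd⟩
    ⟨hc.trans hcd, hd⟩]
  have hint := integrable_abs_sub_rpow_sub_one hp T
  rw [show 2 * H - 1 - 1 = 2 * H - 2 by ring] at hint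
  rw [setIntegral_prod _ hint.integrableOn, Measure.restrict_restrict measurableSet_Ioc,
    Measure.restrict_restrict measurableSet_Ioc,
    inter_eq_left.2 (Ioc_subset_Icc_self.trans (Icc_subset_Icc ha hb)),
    inter_eq_left.2 (Ioc_subset_Icc_self.trans (Icc_subset_Icc hc hd)),
    intervalIntegral.integral_of_le hab]
  simp_rw [intervalIntegral.integral_of_le hcd]

theorem StepData.stronglyMeasurable_toFun {X : Type*} [NormedAddCommGroup X] {t : ℝ} (S : StepData X t) :
    StronglyMeasurable S.toFun := by
  unfold StepData.toFun
  refine Finset.stronglyMeasurable_fun_sum _ fun i _ => ?_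
  exact stronglyMeasurable_const.indicator measurableSet_Ioc

theorem hNormSq_eq_lintegral_prod {X : Type*} [NormedAddCommGroup X] (H T : ℝ) {ψ : ℝ → X}
    (hψ : AEStronglyMeasurable ψ (volume.restrict (Icc 0 T))) :
    hNormSq H T ψ = ENNReal.ofReal (H * (2 * H - 1)) *
      ∫⁻ z, ‖ψ z.1‖ₑ * ‖ψ z.2‖ₑ * ENNReal.ofReal (|z.1 - z.2| ^ (2 * H - 2))
        ∂((volume.restrict (Icc 0 T)).prod (volume.restrict (Icc 0 T))) := by
  rw [hNormSq, lintegral_prod]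
  exact ((hψ.enorm.comp_fst).mul hψ.enorm.comp_snd).mul (by fun_prop)

variable {X : Type*} [NormedAddCommGroup X] [InnerProductSpace ℝ X]

theorem StepData.memLp_integral (hβ : IsFBM H T P β) (S : StepData X T) :
    MemLp (S.integral β) 2 P := by
  unfold StepData.integral
  refine memLp_finsetSum _ fun i _ => ?_
  have h : MemLp (fun ω => β (S.b i) ω - β (S.a i) ω) 2 P :=
    (hβ.memLp ⟨(S.nonneg i).trans (S.le i), S.le_end i⟩).sub
      (hβ.memLp ⟨S.nonneg i, (S.le i).trans (S.le_end i)⟩)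
  refine h.of_le_mul (c := ‖S.c i‖) (h.1.smul_const _) (ae_of_all _ fun ω => ?_)
  rw [norm_smul, mul_comm]

theorem StepData.integral_norm_integral_sq (hH : H ∈ Ioo (1 / 2 : ℝ) 1) (hβ : IsFBM H T P β)
    (S : StepData X T) :
    ∫ ω, ‖S.integral β ω‖ ^ 2 ∂P = H * (2 * H - 1) *
      ∫ z, inner ℝ (S.toFun z.1) (S.toFun z.2) * |z.1 - z.2| ^ (2 * H - 2)
        ∂((volume.restrict (Icc 0 T)).prod (volume.restrict (Icc 0 T))) := by
  have hp : 0 < 2 * H - 1 := by linarith [hH.1]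
  have hint := integrable_abs_sub_rpow_sub_one hp T
  rw [show 2 * H - 1 - 1 = 2 * H - 2 by ring] at hint
  have h1 : ∀ ω, ‖S.integral β ω‖ ^ 2 = ∑ i, ∑ j,
      inner ℝ (S.c i) (S.c j) * ((β (S.b i) ω - β (S.a i) ω) * (β (S.b j) ω - β (S.a j) ω)) := by
    intro ω
    rw [← real_inner_self_eq_norm_sq, StepData.integral, sum_inner]
    refine Finset.sum_congr rfl fun i _ => ?_
    rw [inner_sum]
    refine Finset.sum_congr rfl fun j _ => ?_
    rw [real_inner_smul_left, real_inner_smul_right]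
    ring
  have h2 : ∀ z : ℝ × ℝ, inner ℝ (S.toFun z.1) (S.toFun z.2) * |z.1 - z.2| ^ (2 * H - 2) =
      ∑ i, ∑ j, inner ℝ (S.c i) (S.c j) * (Ioc (S.a i) (S.b i) ×ˢ Ioc (S.a j) (S.b j)).indicator
        (fun z : ℝ × ℝ => |z.1 - z.2| ^ (2 * H - 2)) z := by
    intro z
    simp only [StepData.toFun, sum_inner, inner_sum, Finset.sum_mul]
    rw [Finset.sum_comm]
    refine Finset.sum_congr rfl fun i _ => Finset.sum_congr rfl fun j _ => ?_
    by_cases hi : z.1 ∈ Ioc (S.a i) (S.b i) <;> by_cases hj : z.2 ∈ Ioc (S.a j) (S.b j) <;>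
      simp [indicator, hi, hj, mem_prod]
  have hmem : ∀ i, MemLp (fun ω => β (S.b i) ω - β (S.a i) ω) 2 P := fun i =>
    (hβ.memLp ⟨(S.nonneg i).trans (S.le i), S.le_end i⟩).sub
      (hβ.memLp ⟨S.nonneg i, (S.le i).trans (S.le_end i)⟩)
  have hmm : ∀ i j, Integrable (fun ω => inner ℝ (S.c i) (S.c j) *
      ((β (S.b i) ω - β (S.a i) ω) * (β (S.b j) ω - β (S.a j) ω))) P := fun i j =>
    ((hmem i).integrable_mul (hmem j)).const_mul _
  simp_rw [h1, h2]
  rw [integral_finsetSum _ fun i _ => integrable_finsetSum _ fun j _ => hmm i j,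
    integral_finsetSum _ fun i _ => integrable_finsetSum _ fun j _ =>
      (hint.indicator (measurableSet_Ioc.prod measurableSet_Ioc)).const_mul _, Finset.mul_sum]
  refine Finset.sum_congr rfl fun i _ => ?_
  rw [integral_finsetSum _ fun j _ => hmm i j,
    integral_finsetSum _ fun j _ =>
      (hint.indicator (measurableSet_Ioc.prod measurableSet_Ioc)).const_mul _, Finset.mul_sum]
  refine Finset.sum_congr rfl fun j _ => ?_
  rw [integral_const_mul, integral_const_mul, hβ.integral_increment_mul_eq_prod hH (S.nonneg i)
    (S.le i) (S.le_end i) (S.nonneg j) (S.le j) (S.le_end j),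
    integral_indicator (measurableSet_Ioc.prod measurableSet_Ioc)]
  ring

/-- The exact second moment contains inner products of the values; Cauchy–Schwarz replaces them by
products of norms, which is the `|𝓗|` norm. -/
theorem StepData.ofReal_integral_norm_integral_sq_le (hH : H ∈ Ioo (1 / 2 : ℝ) 1)
    (hβ : IsFBM H T P β) (S : StepData X T) :
    ENNReal.ofReal (∫ ω, ‖S.integral β ω‖ ^ 2 ∂P) ≤ hNormSq H T S.toFun := by
  rw [S.integral_norm_integral_sq hH hβ,
    hNormSq_eq_lintegral_prod H T S.stronglyMeasurable_toFun.aestronglyMeasurable,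
    ENNReal.ofReal_mul (by nlinarith [hH.1])]
  gcongr
  refine (ENNReal.ofReal_le_ofReal (le_abs_self _)).trans ?_
  rw [← Real.enorm_eq_ofReal_abs]
  refine (enorm_integral_le_lintegral_enorm _).trans (lintegral_mono fun z => ?_)
  rw [enorm_mul, ← Real.enorm_of_nonneg (Real.rpow_nonneg (abs_nonneg (z.1 - z.2)) _)]
  gcongr
  rw [← ofReal_norm, ← ofReal_norm, ← ofReal_norm,
    ← ENNReal.ofReal_mul (norm_nonneg _)]
  exact ENNReal.ofReal_le_ofReal (norm_inner_le_norm _ _)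

end Elementary

/-- Lebesgue measure on `[0,T]`. -/
noncomputable abbrev timeMeasure (T : ℝ) : Measure ℝ := volume.restrict (Icc 0 T)

/-! ### Boundedness of the kernel on `L²` -/

section Schur

variable {X : Type*} [NormedAddCommGroup X] {H T : ℝ}

/-- The Schur bound of the kernel `|u - v| ^ (2H - 2)` on `[0,T]`. -/
noncomputable def kernelBound (H T : ℝ) : ℝ := 2 * T ^ (2 * H - 1) / (2 * H - 1)

theorem lintegral_kernel_le (hH : H ∈ Ioo (1 / 2 : ℝ) 1) {u : ℝ} (hu : u ∈ Icc 0 T) :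
    ∫⁻ v in Icc 0 T, ENNReal.ofReal (|u - v| ^ (2 * H - 2)) ≤ ENNReal.ofReal (kernelBound H T) := by
  have := lintegral_abs_sub_rpow_sub_one_le (p := 2 * H - 1) (by linarith [hH.1]) hu
  rwa [show 2 * H - 1 - 1 = 2 * H - 2 by ring] at this

theorem lintegral_sq_mul_kernel_le (hH : H ∈ Ioo (1 / 2 : ℝ) 1) {a : ℝ → ℝ≥0∞}
    (ha : AEMeasurable a (timeMeasure T)) :
    ∫⁻ z, a z.1 ^ (2 : ℝ) * ENNReal.ofReal (|z.1 - z.2| ^ (2 * H - 2))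
        ∂((timeMeasure T).prod (timeMeasure T)) ≤
      ENNReal.ofReal (kernelBound H T) * ∫⁻ u, a u ^ (2 : ℝ) ∂timeMeasure T := by
  have hm : AEMeasurable (fun z : ℝ × ℝ => a z.1 ^ (2 : ℝ) *
      ENNReal.ofReal (|z.1 - z.2| ^ (2 * H - 2))) ((timeMeasure T).prod (timeMeasure T)) :=
    (ha.comp_fst.pow_const _).mul (by fun_prop)
  rw [lintegral_prod _ hm, ← lintegral_const_mul'' _ (ha.pow_const _)]
  refine setLIntegral_mono_ae' measurableSet_Icc (ae_of_all _ fun u hu => ?_)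
  simp only
  rw [lintegral_const_mul _ (by fun_prop), mul_comm]
  gcongr
  exact lintegral_kernel_le hH hu

/-- Schur test: split the symmetric kernel as `k^(1/2) * k^(1/2)`, apply Cauchy–Schwarz on the
square, and bound the integral of `k` in the variable that is free in each factor. -/
theorem lintegral_mul_kernel_le (hH : H ∈ Ioo (1 / 2 : ℝ) 1) {f g : ℝ → X}
    (hf : AEStronglyMeasurable f (timeMeasure T)) (hg : AEStronglyMeasurable g (timeMeasure T)) :
    ∫⁻ z, ‖f z.1‖ₑ * ‖g z.2‖ₑ * ENNReal.ofReal (|z.1 - z.2| ^ (2 * H - 2))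
        ∂((timeMeasure T).prod (timeMeasure T)) ≤
      ENNReal.ofReal (kernelBound H T) *
        (eLpNorm f 2 (timeMeasure T) * eLpNorm g 2 (timeMeasure T)) := by
  set k : ℝ × ℝ → ℝ≥0∞ := fun z => ENNReal.ofReal (|z.1 - z.2| ^ (2 * H - 2)) with hk
  have hkm : Measurable k := by fun_prop
  have hsplit : ∀ z : ℝ × ℝ, ‖f z.1‖ₑ * ‖g z.2‖ₑ * k z =
      (‖f z.1‖ₑ * k z ^ (1 / 2 : ℝ)) * (‖g z.2‖ₑ * k z ^ (1 / 2 : ℝ)) := by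
    intro z
    have : k z ^ (1 / 2 : ℝ) * k z ^ (1 / 2 : ℝ) = k z := by
      rw [← ENNReal.rpow_add_of_nonneg _ _ (by norm_num) (by norm_num)]
      norm_num
    rw [mul_mul_mul_comm, this]
  have hsq : ∀ (x : ℝ≥0∞) (z : ℝ × ℝ), (x * k z ^ (1 / 2 : ℝ)) ^ (2 : ℝ) = x ^ (2 : ℝ) * k z := by
    intro x z
    rw [ENNReal.mul_rpow_of_nonneg _ _ (by norm_num), ← ENNReal.rpow_mul]
    norm_num
  have hL : ∀ h : ℝ → X, eLpNorm h 2 (timeMeasure T) =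
      (∫⁻ u, ‖h u‖ₑ ^ (2 : ℝ) ∂timeMeasure T) ^ (1 / 2 : ℝ) := by
    intro h
    rw [eLpNorm_eq_lintegral_rpow_enorm_toReal (by norm_num) (by norm_num)]
    simp
  rw [lintegral_congr hsplit]
  refine (ENNReal.lintegral_mul_le_Lp_mul_Lq
    (f := fun z : ℝ × ℝ => ‖f z.1‖ₑ * k z ^ (1 / 2 : ℝ))
    (g := fun z : ℝ × ℝ => ‖g z.2‖ₑ * k z ^ (1 / 2 : ℝ)) _ Real.HolderConjugate.two_two
    (hf.enorm.comp_fst.mul (hkm.pow_const _).aemeasurable)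
    (hg.enorm.comp_snd.mul (hkm.pow_const _).aemeasurable)).trans ?_
  simp only [hsq]
  have h1 := lintegral_sq_mul_kernel_le (T := T) hH hf.enorm
  have h2 : ∫⁻ z, ‖g z.2‖ₑ ^ (2 : ℝ) * k z ∂((timeMeasure T).prod (timeMeasure T)) ≤
      ENNReal.ofReal (kernelBound H T) * ∫⁻ u, ‖g u‖ₑ ^ (2 : ℝ) ∂timeMeasure T := by
    rw [← lintegral_prod_swap]
    simpa only [Prod.fst_swap, Prod.snd_swap, hk, abs_sub_comm] using
      lintegral_sq_mul_kernel_le (T := T) hH hg.enorm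
  calc _ ≤ (ENNReal.ofReal (kernelBound H T) * ∫⁻ u, ‖f u‖ₑ ^ (2 : ℝ) ∂timeMeasure T) ^ (1 / 2 : ℝ) *
      (ENNReal.ofReal (kernelBound H T) * ∫⁻ u, ‖g u‖ₑ ^ (2 : ℝ) ∂timeMeasure T) ^ (1 / 2 : ℝ) := by
        gcongr
    _ = _ := by
        rw [hL, hL, ENNReal.mul_rpow_of_nonneg _ _ (by norm_num),
          ENNReal.mul_rpow_of_nonneg _ _ (by norm_num), mul_mul_mul_comm,
          ← ENNReal.rpow_add_of_nonneg _ _ (by norm_num) (by norm_num)]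
        norm_num

theorem hNormSq_le (hH : H ∈ Ioo (1 / 2 : ℝ) 1) {f : ℝ → X}
    (hf : AEStronglyMeasurable f (timeMeasure T)) :
    hNormSq H T f ≤ ENNReal.ofReal (H * (2 * H - 1) * kernelBound H T) *
      eLpNorm f 2 (timeMeasure T) ^ 2 := by
  rw [hNormSq_eq_lintegral_prod H T hf, ENNReal.ofReal_mul (p := H * (2 * H - 1)) (by nlinarith [hH.1]), mul_assoc, sq]
  gcongr
  exact lintegral_mul_kernel_le hH hf hf

/-- Upper semicontinuity of `hNormSq` with respect to `L²`, with an explicit error. -/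
theorem hNormSq_le_add (hH : H ∈ Ioo (1 / 2 : ℝ) 1) {f g : ℝ → X}
    (hf : AEStronglyMeasurable f (timeMeasure T)) (hg : AEStronglyMeasurable g (timeMeasure T)) :
    hNormSq H T g ≤ hNormSq H T f + ENNReal.ofReal (H * (2 * H - 1) * kernelBound H T) *
      (eLpNorm f 2 (timeMeasure T) * eLpNorm (f - g) 2 (timeMeasure T) +
        eLpNorm (f - g) 2 (timeMeasure T) * eLpNorm f 2 (timeMeasure T) +
        eLpNorm (f - g) 2 (timeMeasure T) * eLpNorm (f - g) 2 (timeMeasure T)) := by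
  have hd := hf.sub hg
  rw [hNormSq_eq_lintegral_prod H T hf, hNormSq_eq_lintegral_prod H T hg,
    ENNReal.ofReal_mul (p := H * (2 * H - 1)) (by nlinarith [hH.1]), mul_assoc (ENNReal.ofReal _),
    ← mul_add]
  gcongr
  set k : ℝ × ℝ → ℝ≥0∞ := fun z => ENNReal.ofReal (|z.1 - z.2| ^ (2 * H - 2)) with hk
  have hkm : Measurable k := by fun_prop
  have hle : ∀ u, ‖g u‖ₑ ≤ ‖f u‖ₑ + ‖(f - g) u‖ₑ := by
    intro u
    have := enorm_sub_le (E := X) (a := f u) (b := (f - g) u)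
    simpa using this
  have hmeas : ∀ {a b : ℝ → X}, AEStronglyMeasurable a (timeMeasure T) →
      AEStronglyMeasurable b (timeMeasure T) →
      AEMeasurable (fun z : ℝ × ℝ => ‖a z.1‖ₑ * ‖b z.2‖ₑ * k z)
        ((timeMeasure T).prod (timeMeasure T)) := fun ha hb =>
    (ha.enorm.comp_fst.mul hb.enorm.comp_snd).mul hkm.aemeasurable
  calc ∫⁻ z, ‖g z.1‖ₑ * ‖g z.2‖ₑ * k z ∂((timeMeasure T).prod (timeMeasure T))
      ≤ ∫⁻ z, ‖f z.1‖ₑ * ‖f z.2‖ₑ * k z + ‖f z.1‖ₑ * ‖(f - g) z.2‖ₑ * k z +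
          ‖(f - g) z.1‖ₑ * ‖f z.2‖ₑ * k z + ‖(f - g) z.1‖ₑ * ‖(f - g) z.2‖ₑ * k z
          ∂((timeMeasure T).prod (timeMeasure T)) := by
        refine lintegral_mono fun z => ?_
        calc _ ≤ (‖f z.1‖ₑ + ‖(f - g) z.1‖ₑ) * (‖f z.2‖ₑ + ‖(f - g) z.2‖ₑ) * k z := by
              gcongr <;> exact hle _
          _ = _ := by ring
    _ ≤ _ := by
        rw [lintegral_add_right' _ (hmeas hd hd), lintegral_add_right' _ (hmeas hd hf),
          lintegral_add_right' _ (hmeas hf hd), mul_add, mul_add, add_assoc, add_assoc, add_assoc]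
        gcongr
        · exact lintegral_mul_kernel_le hH hf hd
        · exact lintegral_mul_kernel_le hH hd hf
        · exact lintegral_mul_kernel_le hH hd hd

end Schur

/-! ### Density of step functions -/

section StepFunctions

variable {X : Type*} [NormedAddCommGroup X] {t : ℝ}

theorem StepData.memLp_toFun (S : StepData X t) : MemLp S.toFun 2 (timeMeasure t) := by
  unfold StepData.toFun
  exact memLp_finsetSum _ fun i _ => memLp_indicator_const 2 measurableSet_Ioc _
    (Or.inr (measure_ne_top _ _))

/-- The step function that samples `h` at the left end points of `n` intervals of equal length. -/
noncomputable def StepData.sample (ht : 0 ≤ t) (n : ℕ) (h : ℝ → X) : StepData X t where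
  n := n
  a i := i * (t / n)
  b i := (i + 1) * (t / n)
  c i := h (i * (t / n))
  nonneg i := by positivity
  le i := by gcongr; linarith
  le_end i := by
    have h0 : (0 : ℝ) < n := by exact_mod_cast i.pos
    have h1 : ((i : ℕ) : ℝ) + 1 ≤ n := by exact_mod_cast i.isLt
    calc ((i : ℕ) + 1 : ℝ) * (t / n) ≤ n * (t / n) := by gcongr
      _ = t := by field_simp

theorem StepData.sample_toFun (ht : 0 ≤ t) {n : ℕ} (hn : 0 < n) (h : ℝ → X) {s : ℝ}
    (hs : s ∈ Ioc 0 t) :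
    ∃ r ∈ Icc 0 t, |s - r| ≤ t / n ∧ (StepData.sample ht n h).toFun s = h r := by
  have ht0 : 0 < t := hs.1.trans_le hs.2
  have hn0 : (0 : ℝ) < n := by exact_mod_cast hn
  set d := t / n with hd
  have hd0 : 0 < d := by positivity
  have htd : t = n * d := by rw [hd]; field_simp
  -- The cells are open on the left and closed on the right, so the cell containing `s` has index
  -- `⌈s / d⌉ - 1`.
  obtain ⟨m, hm⟩ : ∃ m, ⌈s / d⌉₊ = m + 1 :=
    Nat.exists_eq_succ_of_ne_zero (Nat.ceil_pos.2 (div_pos hs.1 hd0)).ne'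
  have h1 : s ≤ (m + 1) * d := by
    have := Nat.le_ceil (s / d)
    rw [hm, div_le_iff₀ hd0] at this
    exact_mod_cast this
  have h2 : m * d < s := by
    have : m < ⌈s / d⌉₊ := by omega
    rw [Nat.lt_ceil, lt_div_iff₀ hd0] at this
    exact this
  have h3 : m < n := by
    have : (m : ℝ) * d < n * d := by linarith [hs.2]
    exact_mod_cast lt_of_mul_lt_mul_right this hd0.le
  refine ⟨m * d, ⟨by positivity, by linarith [hs.2]⟩, by rw [abs_of_pos] <;> linarith, ?_⟩
  unfold StepData.toFun
  refine (Finset.sum_eq_single (⟨m, h3⟩ : Fin n) ?_ fun h => absurd (Finset.mem_univ _) h).trans ?_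
  · intro i _ hi
    refine indicator_of_notMem (fun hmem => hi ?_) _
    have h4 : (i : ℕ) * d < (m + 1) * d := hmem.1.trans_le h1
    have h5 : (m : ℝ) * d < ((i : ℕ) + 1) * d := h2.trans_le hmem.2
    have h6 : (i : ℕ) < m + 1 := by exact_mod_cast lt_of_mul_lt_mul_right h4 hd0.le
    have h7 : m < (i : ℕ) + 1 := by exact_mod_cast lt_of_mul_lt_mul_right h5 hd0.le
    exact Fin.ext (by simp only; omega)
  · exact indicator_of_mem (show s ∈ Ioc (m * d) ((m + 1) * d) from ⟨h2, h1⟩) _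

theorem ae_mem_Ioc_timeMeasure (t : ℝ) : ∀ᵐ s ∂timeMeasure t, s ∈ Ioc 0 t := by
  rw [timeMeasure, ← Measure.restrict_congr_set Ioc_ae_eq_Icc]
  exact ae_restrict_mem measurableSet_Ioc

/-- Bounded continuous functions are dense in `L²`, and on the compact interval such a function is
uniformly close to its samples on a fine grid. -/
theorem exists_stepData_tendsto [NormedSpace ℝ X] (ht : 0 ≤ t) {f : ℝ → X}
    (hf : MemLp f 2 (timeMeasure t)) :
    ∃ S : ℕ → StepData X t,
      Tendsto (fun k => eLpNorm (f - (S k).toFun) 2 (timeMeasure t)) atTop (𝓝 0) := by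
  have key : ∀ ε : ℝ, 0 < ε → ∃ S : StepData X t,
      eLpNorm (f - S.toFun) 2 (timeMeasure t) ≤ ENNReal.ofReal ε := by
    intro ε hε
    obtain ⟨g, hg, -⟩ := hf.exists_boundedContinuous_eLpNorm_sub_le (by norm_num)
      (ε := ENNReal.ofReal (ε / 2)) (by simpa using hε)
    -- The factor converting a uniform bound into an `L²` bound; `c + 1` is used below to avoid
    -- dividing by zero.
    set c : ℝ := (timeMeasure t univ ^ (2 : ℝ≥0∞).toReal⁻¹).toReal with hc
    have hc0 : 0 ≤ c := ENNReal.toReal_nonneg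
    obtain ⟨δ, hδ, hgδ⟩ := Metric.uniformContinuousOn_iff_le.1
      (isCompact_Icc.uniformContinuousOn_of_continuous (g.continuous.continuousOn (s := Icc 0 t)))
      (ε / 2 / (c + 1)) (by positivity)
    obtain ⟨n, hn⟩ := exists_nat_gt (t / δ)
    have hn0 : (0 : ℝ) < n := lt_of_le_of_lt (by positivity) hn
    refine ⟨StepData.sample ht n g, ?_⟩
    have hb : eLpNorm (⇑g - (StepData.sample ht n g).toFun) 2 (timeMeasure t) ≤
        ENNReal.ofReal (ε / 2) := by
      refine (eLpNorm_le_of_ae_bound (C := ε / 2 / (c + 1)) ?_).trans ?_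
      · filter_upwards [ae_mem_Ioc_timeMeasure t] with s hs
        obtain ⟨r, hr, hsr, hval⟩ := StepData.sample_toFun ht (by exact_mod_cast hn0) (⇑g) hs
        rw [Pi.sub_apply, hval, ← dist_eq_norm]
        refine hgδ s ⟨hs.1.le, hs.2⟩ r hr (hsr.trans ?_)
        rw [div_le_iff₀ hn0, mul_comm, ← div_le_iff₀ hδ]
        exact hn.le
      · rw [← ENNReal.ofReal_toReal (a := timeMeasure t univ ^ (2 : ℝ≥0∞).toReal⁻¹)
          (ENNReal.rpow_ne_top_of_nonneg (by simp) (measure_ne_top _ _)), ← hc,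
          ← ENNReal.ofReal_mul hc0]
        refine ENNReal.ofReal_le_ofReal ?_
        rw [mul_div_assoc', div_le_iff₀ (by positivity)]
        nlinarith
    have hsum : f - (StepData.sample ht n g).toFun =
        (f - ⇑g) + (⇑g - (StepData.sample ht n g).toFun) := by abel
    rw [hsum]
    refine (eLpNorm_add_le (hf.1.sub g.continuous.aestronglyMeasurable)
      (g.continuous.aestronglyMeasurable.sub (StepData.stronglyMeasurable_toFun _).aestronglyMeasurable)
      (by norm_num)).trans ((add_le_add hg hb).trans_eq ?_)
    rw [← ENNReal.ofReal_add (by positivity) (by positivity), add_halves]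
  choose S hS using fun k : ℕ => key (1 / ((k : ℝ) + 1)) (by positivity)
  refine ⟨S, tendsto_of_tendsto_of_tendsto_of_le_of_le tendsto_const_nhds ?_
    (fun _ => zero_le) hS⟩
  simpa using ENNReal.tendsto_ofReal (tendsto_one_div_add_atTop_nhds_zero_nat (𝕜 := ℝ))

/-- Concatenation of step data, representing the sum of the step functions. -/
def StepData.append (S S' : StepData X t) : StepData X t where
  n := S.n + S'.n
  a := Fin.append S.a S'.a
  b := Fin.append S.b S'.b
  c := Fin.append S.c S'.c
  nonneg i := by refine Fin.addCases (fun i => ?_) (fun i => ?_) i <;> simp [S.nonneg, S'.nonneg]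
  le i := by refine Fin.addCases (fun i => ?_) (fun i => ?_) i <;> simp [S.le, S'.le]
  le_end i := by refine Fin.addCases (fun i => ?_) (fun i => ?_) i <;> simp [S.le_end, S'.le_end]

/-- The step data of a multiple of a step function. -/
def StepData.smul [NormedSpace ℝ X] (κ : ℝ) (S : StepData X t) : StepData X t :=
  { S with c := fun i => κ • S.c i }

/-- Step data on `[0,t]` as step data on a longer interval. -/
def StepData.extend {T : ℝ} (htT : t ≤ T) (S : StepData X t) : StepData X T :=
  { S with le_end := fun i => (S.le_end i).trans htT }

theorem StepData.append_toFun (S S' : StepData X t) (s : ℝ) :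
    (S.append S').toFun s = S.toFun s + S'.toFun s := by
  refine (Fin.sum_univ_add _).trans ?_
  simp [StepData.toFun, StepData.append]

theorem StepData.smul_toFun [NormedSpace ℝ X] (κ : ℝ) (S : StepData X t) (s : ℝ) :
    (S.smul κ).toFun s = κ • S.toFun s := by
  simp only [StepData.toFun, Finset.smul_sum]
  exact Finset.sum_congr rfl fun i _ => indicator_const_smul_apply _ _ _ _

theorem StepData.append_integral [NormedSpace ℝ X] {Ω : Type*} (S S' : StepData X t)
    (β : ℝ → Ω → ℝ) (ω : Ω) :
    (S.append S').integral β ω = S.integral β ω + S'.integral β ω := by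
  refine (Fin.sum_univ_add _).trans ?_
  simp [StepData.integral, StepData.append]

theorem StepData.smul_integral [NormedSpace ℝ X] {Ω : Type*} (κ : ℝ) (S : StepData X t)
    (β : ℝ → Ω → ℝ) (ω : Ω) : (S.smul κ).integral β ω = κ • S.integral β ω := by
  simp only [StepData.integral, Finset.smul_sum]
  exact Finset.sum_congr rfl fun i _ => smul_comm _ _ _

end StepFunctions

/-! ### The Wiener integral as a bounded operator on `L²([0,T], X)` -/

section WienerMap

variable {Ω : Type*} [MeasurableSpace Ω] {P : Measure Ω} {H T : ℝ} {β : ℝ → Ω → ℝ}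
  {X : Type*} [NormedAddCommGroup X]

theorem hNormSq_congr {f g : ℝ → X} (h : f =ᵐ[timeMeasure T] g) : hNormSq H T f = hNormSq H T g := by
  unfold hNormSq
  congr 1
  refine lintegral_congr_ae ?_
  filter_upwards [h] with u hu
  refine lintegral_congr_ae ?_
  filter_upwards [h] with v hv
  rw [hu, hv]

/-- Extension by zero places integrands on different intervals `[0,t]` in the single space
`L²([0,T])`, where integrals up to different times can be compared. -/
theorem hNormSq_indicator {t : ℝ} (htT : t ≤ T) (ψ : ℝ → X) :
    hNormSq H T ((Icc 0 t).indicator ψ) = hNormSq H t ψ := by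
  unfold hNormSq
  congr 1
  have hsub : Icc 0 t ∩ Icc 0 T = Icc 0 t := inter_eq_left.2 (Icc_subset_Icc_right htT)
  rw [← hsub, ← setLIntegral_indicator measurableSet_Icc, hsub]
  refine lintegral_congr fun u => ?_
  by_cases hu : u ∈ Icc 0 t
  · rw [indicator_of_mem hu, indicator_of_mem hu]
    conv_rhs => rw [← hsub, ← setLIntegral_indicator measurableSet_Icc]
    refine lintegral_congr fun v => ?_
    by_cases hv : v ∈ Icc 0 t
    · rw [indicator_of_mem hv, indicator_of_mem hv]
    · rw [indicator_of_notMem hv, indicator_of_notMem hv]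
      simp
  · rw [indicator_of_notMem hu, indicator_of_notMem hu]
    simp

theorem eLpNorm_indicator_timeMeasure {t : ℝ} (htT : t ≤ T) (ψ : ℝ → X) :
    eLpNorm ((Icc 0 t).indicator ψ) 2 (timeMeasure T) = eLpNorm ψ 2 (timeMeasure t) := by
  rw [eLpNorm_indicator_eq_eLpNorm_restrict measurableSet_Icc,
    Measure.restrict_restrict measurableSet_Icc, inter_eq_left.2 (Icc_subset_Icc_right htT)]

theorem tendsto_toLp_of_tendsto_eLpNorm {μ : Measure ℝ} {S : ℕ → ℝ → X} (hS : ∀ k, MemLp (S k) 2 μ)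
    {f : Lp X 2 μ} (h : Tendsto (fun k => eLpNorm (⇑f - S k) 2 μ) atTop (𝓝 0)) :
    Tendsto (fun k => (hS k).toLp) atTop (𝓝 f) := by
  rw [Lp.tendsto_Lp_iff_tendsto_eLpNorm']
  refine h.congr fun k => ?_
  rw [eLpNorm_sub_comm]
  refine eLpNorm_congr_ae ?_
  filter_upwards [(hS k).coeFn_toLp] with s hs
  simp [hs]

theorem exists_stepData_tendsto_toLp [NormedSpace ℝ X] (hT : 0 ≤ T) (f : Lp X 2 (timeMeasure T)) :
    ∃ S : ℕ → StepData X T, Tendsto (fun k => (S k).memLp_toFun.toLp) atTop (𝓝 f) := by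
  obtain ⟨S, hS⟩ := exists_stepData_tendsto hT (Lp.memLp f)
  exact ⟨S, tendsto_toLp_of_tendsto_eLpNorm _ hS⟩

theorem memLp_indicator_timeMeasure {t : ℝ} (htT : t ≤ T) {ψ : ℝ → X}
    (hψ : MemLp ψ 2 (timeMeasure t)) : MemLp ((Icc 0 t).indicator ψ) 2 (timeMeasure T) := by
  rw [memLp_indicator_iff_restrict measurableSet_Icc, Measure.restrict_restrict measurableSet_Icc,
    inter_eq_left.2 (Icc_subset_Icc_right htT)]
  exact hψ

theorem StepData.indicator_toFun {t : ℝ} (S : StepData X t) :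
    (Icc 0 t).indicator S.toFun = S.toFun := by
  refine indicator_eq_self.2 fun s hs => ?_
  by_contra h
  refine hs (Finset.sum_eq_zero fun i _ => indicator_of_notMem (fun hi => h ?_) _)
  exact ⟨(S.nonneg i).trans hi.1.le, hi.2.trans (S.le_end i)⟩

/-- The norm bound for the Wiener integral on `L²([0,T])`. -/
noncomputable def wienerBound (H T : ℝ) : ℝ := √(H * (2 * H - 1) * kernelBound H T)

theorem wienerBound_sq (hH : H ∈ Ioo (1 / 2 : ℝ) 1) (hT : 0 ≤ T) :
    wienerBound H T ^ 2 = H * (2 * H - 1) * kernelBound H T := by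
  have h1 : 0 < 2 * H - 1 := by linarith [hH.1]
  have h2 : 0 < H := by linarith
  refine Real.sq_sqrt ?_
  unfold kernelBound
  positivity

theorem norm_le_of_ofReal_norm_sq_le (hH : H ∈ Ioo (1 / 2 : ℝ) 1) (hT : 0 ≤ T)
    {f : Lp X 2 (timeMeasure T)} {I : Lp X 2 P} (h : ENNReal.ofReal (‖I‖ ^ 2) ≤ hNormSq H T f) :
    ‖I‖ ≤ wienerBound H T * ‖f‖ := by
  have h1 := h.trans (hNormSq_le hH (Lp.aestronglyMeasurable f))
  have h0 : 0 ≤ wienerBound H T := Real.sqrt_nonneg _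
  rw [← wienerBound_sq hH hT, ← ENNReal.ofReal_toReal (Lp.eLpNorm_ne_top f), ← Lp.norm_def,
    ← ENNReal.ofReal_pow (norm_nonneg _), ← ENNReal.ofReal_mul (by positivity), ← mul_pow,
    ENNReal.ofReal_le_ofReal_iff (by positivity)] at h1
  exact le_of_sq_le_sq h1 (by positivity)

variable [InnerProductSpace ℝ X]

theorem norm_sq_eq_of_ae {f : Lp X 2 P} {F : Ω → X} (h : f =ᵐ[P] F) :
    ‖f‖ ^ 2 = ∫ ω, ‖F ω‖ ^ 2 ∂P := by
  rw [← real_inner_self_eq_norm_sq, L2.inner_def]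
  refine integral_congr_ae ?_
  filter_upwards [h] with ω hω
  rw [hω, real_inner_self_eq_norm_sq]

/-- The pairs consisting of (the class of) a step function and of its elementary integral. -/
def stepPairs (T : ℝ) (P : Measure Ω) (β : ℝ → Ω → ℝ) (X : Type*) [NormedAddCommGroup X]
    [InnerProductSpace ℝ X] : Submodule ℝ (Lp X 2 (timeMeasure T) × Lp X 2 P) where
  carrier := {p | ∃ S : StepData X T, p.1 =ᵐ[timeMeasure T] S.toFun ∧ p.2 =ᵐ[P] S.integral β}
  zero_mem' := by
    refine ⟨⟨0, Fin.elim0, Fin.elim0, Fin.elim0, fun i => i.elim0, fun i => i.elim0,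
      fun i => i.elim0⟩, ?_, ?_⟩
    · filter_upwards [Lp.coeFn_zero X 2 (timeMeasure T)] with s hs
      rw [Prod.fst_zero, hs]
      simp [StepData.toFun]
    · filter_upwards [Lp.coeFn_zero X 2 P] with s hs
      rw [Prod.snd_zero, hs]
      simp [StepData.integral]
  add_mem' := by
    rintro p q ⟨S, h1, h2⟩ ⟨S', h3, h4⟩
    refine ⟨S.append S', ?_, ?_⟩
    · filter_upwards [Lp.coeFn_add p.1 q.1, h1, h3] with s hs hs1 hs3
      rw [Prod.fst_add, hs, Pi.add_apply, hs1, hs3, StepData.append_toFun]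
    · filter_upwards [Lp.coeFn_add p.2 q.2, h2, h4] with s hs hs1 hs3
      rw [Prod.snd_add, hs, Pi.add_apply, hs1, hs3, StepData.append_integral]
  smul_mem' := by
    rintro κ p ⟨S, h1, h2⟩
    refine ⟨S.smul κ, ?_, ?_⟩
    · filter_upwards [Lp.coeFn_smul κ p.1, h1] with s hs hs1
      rw [Prod.smul_fst, hs, Pi.smul_apply, hs1, StepData.smul_toFun]
    · filter_upwards [Lp.coeFn_smul κ p.2, h2] with s hs hs1
      rw [Prod.smul_snd, hs, Pi.smul_apply, hs1, StepData.smul_integral]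

theorem mem_stepPairs (hβ : IsFBM H T P β) (S : StepData X T) :
    (S.memLp_toFun.toLp, (S.memLp_integral hβ).toLp) ∈ stepPairs T P β X :=
  ⟨S, S.memLp_toFun.coeFn_toLp, (S.memLp_integral hβ).coeFn_toLp⟩

theorem ofReal_norm_sq_le_of_mem_stepPairs (hH : H ∈ Ioo (1 / 2 : ℝ) 1) (hβ : IsFBM H T P β)
    {p : Lp X 2 (timeMeasure T) × Lp X 2 P} (hp : p ∈ stepPairs T P β X) :
    ENNReal.ofReal (‖p.2‖ ^ 2) ≤ hNormSq H T p.1 := by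
  obtain ⟨S, h1, h2⟩ := hp
  rw [norm_sq_eq_of_ae h2, hNormSq_congr h1]
  exact S.ofReal_integral_norm_integral_sq_le hH hβ

/-- A step function has many representations, so its elementary integral is not visibly a function
of its class. Working with the space of pairs, the norm bound gives both well-definedness and
continuity, and density gives the extension. -/
theorem denseRange_and_norm_le_stepPairs (hH : H ∈ Ioo (1 / 2 : ℝ) 1) (hT : 0 ≤ T) (hβ : IsFBM H T P β) :
    DenseRange ((LinearMap.fst ℝ (Lp X 2 (timeMeasure T)) (Lp X 2 P)).comp
      (stepPairs T P β X).subtype) ∧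
    ∀ x, ‖((LinearMap.snd ℝ (Lp X 2 (timeMeasure T)) (Lp X 2 P)).comp
      (stepPairs T P β X).subtype) x‖ ≤ wienerBound H T *
      ‖((LinearMap.fst ℝ (Lp X 2 (timeMeasure T)) (Lp X 2 P)).comp
      (stepPairs T P β X).subtype) x‖ := by
  refine ⟨fun f => ?_, fun x =>
    norm_le_of_ofReal_norm_sq_le hH hT (ofReal_norm_sq_le_of_mem_stepPairs hH hβ x.2)⟩
  obtain ⟨S, hS⟩ := exists_stepData_tendsto_toLp hT f
  exact mem_closure_of_tendsto hS
    (Eventually.of_forall fun k => ⟨⟨_, mem_stepPairs hβ (S k)⟩, rfl⟩)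

variable [CompleteSpace X]

/-- The Wiener integral over `[0,T]` as a map on `L²([0,T])`: the continuous extension of the
elementary integral. -/
noncomputable def wienerMap (T : ℝ) (P : Measure Ω) (β : ℝ → Ω → ℝ) (X : Type*)
    [NormedAddCommGroup X] [InnerProductSpace ℝ X] [CompleteSpace X] :
    Lp X 2 (timeMeasure T) →L[ℝ] Lp X 2 P :=
  ((LinearMap.snd ℝ (Lp X 2 (timeMeasure T)) (Lp X 2 P)).comp
    (stepPairs T P β X).subtype).extendOfNorm
      ((LinearMap.fst ℝ (Lp X 2 (timeMeasure T)) (Lp X 2 P)).comp (stepPairs T P β X).subtype)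

theorem wienerMap_fst (hH : H ∈ Ioo (1 / 2 : ℝ) 1) (hT : 0 ≤ T) (hβ : IsFBM H T P β)
    {p : Lp X 2 (timeMeasure T) × Lp X 2 P} (hp : p ∈ stepPairs T P β X) :
    wienerMap T P β X p.1 = p.2 :=
  have h := denseRange_and_norm_le_stepPairs (X := X) hH hT hβ
  LinearMap.extendOfNorm_eq h.1 ⟨_, h.2⟩ (⟨p, hp⟩ : stepPairs T P β X)

theorem norm_wienerMap_le (hH : H ∈ Ioo (1 / 2 : ℝ) 1) (hT : 0 ≤ T) (hβ : IsFBM H T P β)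
    (f : Lp X 2 (timeMeasure T)) : ‖wienerMap T P β X f‖ ≤ wienerBound H T * ‖f‖ :=
  have h := denseRange_and_norm_le_stepPairs (X := X) hH hT hβ
  LinearMap.norm_extendOfNorm_apply_le h.1 _ h.2 f

theorem wienerMap_toLp (hH : H ∈ Ioo (1 / 2 : ℝ) 1) (hT : 0 ≤ T) (hβ : IsFBM H T P β)
    (S : StepData X T) :
    wienerMap T P β X S.memLp_toFun.toLp = (S.memLp_integral hβ).toLp :=
  wienerMap_fst hH hT hβ (mem_stepPairs hβ S)

/-- The `L²` bound is not enough, since Wiener integrals are defined through convergence in `|𝓗|`.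
The sharper bound holds for step functions and survives `L²` limits, because the error in
`hNormSq_le_add` vanishes. -/
theorem ofReal_norm_wienerMap_sq_le (hH : H ∈ Ioo (1 / 2 : ℝ) 1) (hT : 0 ≤ T)
    (hβ : IsFBM H T P β) (f : Lp X 2 (timeMeasure T)) :
    ENNReal.ofReal (‖wienerMap T P β X f‖ ^ 2) ≤ hNormSq H T f := by
  obtain ⟨S, hS⟩ := exists_stepData_tendsto hT (Lp.memLp f)
  have hSf := tendsto_toLp_of_tendsto_eLpNorm (fun k => (S k).memLp_toFun) hS
  have h1 : Tendsto (fun k => ENNReal.ofReal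
      (‖wienerMap T P β X ((S k).memLp_toFun.toLp)‖ ^ 2)) atTop
      (𝓝 (ENNReal.ofReal (‖wienerMap T P β X f‖ ^ 2))) :=
    ENNReal.tendsto_ofReal ((((wienerMap T P β X).continuous.tendsto f).comp hSf).norm.pow 2)
  set c := ENNReal.ofReal (H * (2 * H - 1) * kernelBound H T)
  have hfin : eLpNorm f 2 (timeMeasure T) ≠ ∞ := Lp.eLpNorm_ne_top f
  have h2 : Tendsto (fun k => hNormSq H T f + c *
      (eLpNorm f 2 (timeMeasure T) * eLpNorm (⇑f - (S k).toFun) 2 (timeMeasure T) +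
        eLpNorm (⇑f - (S k).toFun) 2 (timeMeasure T) * eLpNorm f 2 (timeMeasure T) +
        eLpNorm (⇑f - (S k).toFun) 2 (timeMeasure T) *
          eLpNorm (⇑f - (S k).toFun) 2 (timeMeasure T))) atTop (𝓝 (hNormSq H T f)) := by
    have ha := ENNReal.Tendsto.const_mul hS (Or.inr hfin)
    have hb := ENNReal.Tendsto.mul_const hS (Or.inr hfin)
    have hc := ENNReal.Tendsto.mul hS (Or.inr ENNReal.zero_ne_top) hS (Or.inr ENNReal.zero_ne_top)
    have := ((ha.add hb).add hc)
    have h3 := (ENNReal.Tendsto.const_mul (a := c) this (Or.inr ENNReal.ofReal_ne_top)).const_add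
      (hNormSq H T f)
    simpa using h3
  refine le_of_tendsto_of_tendsto' h1 h2 fun k => ?_
  rw [wienerMap_toLp hH hT hβ]
  refine (ofReal_norm_sq_le_of_mem_stepPairs hH hβ (mem_stepPairs hβ (S k))).trans ?_
  rw [hNormSq_congr (S k).memLp_toFun.coeFn_toLp]
  exact hNormSq_le_add hH (Lp.aestronglyMeasurable f)
    (S k).stronglyMeasurable_toFun.aestronglyMeasurable

/-- Forward: by the `|𝓗|` bound for `wienerMap`, every admissible approximating sequence has
integrals tending to the same limit. Backward: step functions converging in `L²` also converge in
`|𝓗|`, by `hNormSq_le`. -/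
theorem isWienerIntegral_iff (hH : H ∈ Ioo (1 / 2 : ℝ) 1) (hβ : IsFBM H T P β) {t : ℝ}
    (ht : t ∈ Icc 0 T) {ψ : ℝ → X} (hψ : MemLp ψ 2 (timeMeasure t)) (I : Lp X 2 P) :
    IsWienerIntegral H P β t ψ I ↔
      I = wienerMap T P β X (memLp_indicator_timeMeasure ht.2 hψ).toLp := by
  have hT : 0 ≤ T := ht.1.trans ht.2
  set F := (memLp_indicator_timeMeasure ht.2 hψ).toLp with hF
  have hsub : ∀ S : StepData X t, (Icc 0 t).indicator ψ - S.toFun =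
      (Icc 0 t).indicator (fun s => ψ s - S.toFun s) := fun S => by
    conv_lhs => rw [← S.indicator_toFun]
    exact (indicator_sub' _ _ _).symm
  have hint : ∀ S : StepData X t, MemLp (S.integral β) 2 P :=
    fun S => (S.extend ht.2).memLp_integral hβ
  have hto : ∀ S : StepData X t, MemLp S.toFun 2 (timeMeasure T) :=
    fun S => (S.extend ht.2).memLp_toFun
  have hW : ∀ S : StepData X t, wienerMap T P β X (hto S).toLp = (hint S).toLp :=
    fun S => wienerMap_toLp hH hT hβ (S.extend ht.2)
  have hlp : ∀ (S : ℕ → StepData X t) (J : Lp X 2 P),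
      Tendsto (fun k => eLpNorm (fun ω => (S k).integral β ω - J ω) 2 P) atTop (𝓝 0) ↔
        Tendsto (fun k => (hint (S k)).toLp) atTop (𝓝 J) := by
    intro S J
    rw [Lp.tendsto_Lp_iff_tendsto_eLpNorm']
    refine tendsto_congr fun k => eLpNorm_congr_ae ?_
    filter_upwards [(hint (S k)).coeFn_toLp] with ω hω
    simp [hω]
  constructor
  · rintro ⟨-, S, hS, hI⟩
    refine tendsto_nhds_unique ((hlp S I).1 hI) ?_
    have h0 : Tendsto (fun k => ENNReal.ofReal
        (‖wienerMap T P β X (F - (hto (S k)).toLp)‖ ^ 2)) atTop (𝓝 0) := by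
      refine tendsto_of_tendsto_of_tendsto_of_le_of_le tendsto_const_nhds hS (fun _ => zero_le)
        fun k => (ofReal_norm_wienerMap_sq_le hH hT hβ _).trans_eq ?_
      rw [hF, ← MemLp.toLp_sub, hNormSq_congr (MemLp.coeFn_toLp _), hsub, hNormSq_indicator ht.2]
    rw [tendsto_iff_norm_sub_tendsto_zero]
    have h1 := (ENNReal.tendsto_toReal ENNReal.zero_ne_top).comp h0
    simp only [Function.comp_def, ENNReal.toReal_zero, ENNReal.toReal_ofReal (sq_nonneg _)] at h1
    have h2 := h1.sqrt
    simp only [Real.sqrt_sq (norm_nonneg _), Real.sqrt_zero] at h2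
    refine h2.congr fun k => ?_
    rw [map_sub, hW, norm_sub_rev]
  · rintro rfl
    obtain ⟨S, hS⟩ := exists_stepData_tendsto ht.1 hψ
    refine ⟨hψ.1, S, ?_, (hlp S _).2 ?_⟩
    · have h1 := (ENNReal.Tendsto.const_mul (a := ENNReal.ofReal (H * (2 * H - 1) *
        kernelBound H t)) (ENNReal.Tendsto.pow (n := 2) hS) (Or.inr ENNReal.ofReal_ne_top))
      refine tendsto_of_tendsto_of_tendsto_of_le_of_le tendsto_const_nhds (by simpa using h1)
        (fun _ => zero_le) fun k => ?_
      exact hNormSq_le hH (hψ.1.sub (S k).stronglyMeasurable_toFun.aestronglyMeasurable)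
    · simp_rw [← hW]
      refine ((wienerMap T P β X).continuous.tendsto F).comp
        (tendsto_toLp_of_tendsto_eLpNorm (fun k => hto (S k)) ?_)
      refine hS.congr fun k => ?_
      rw [← eLpNorm_indicator_timeMeasure ht.2]
      refine (eLpNorm_congr_ae ?_).symm
      filter_upwards [(memLp_indicator_timeMeasure ht.2 hψ).coeFn_toLp] with s hs
      rw [Pi.sub_apply, hF, hs, ← Pi.sub_apply, hsub]
      rfl

end WienerMap

/-! ### Orthogonal series -/

section OrthogonalSeries

variable {ι E : Type*} [NormedAddCommGroup E] [InnerProductSpace ℝ E]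

theorem norm_sum_sq_of_pairwise_inner_eq_zero {v : ι → E}
    (hv : Pairwise fun m n => inner ℝ (v m) (v n) = 0) (s : Finset ι) :
    ‖∑ n ∈ s, v n‖ ^ 2 = ∑ n ∈ s, ‖v n‖ ^ 2 := by
  rw [← real_inner_self_eq_norm_sq, sum_inner]
  refine Finset.sum_congr rfl fun m hm => ?_
  rw [inner_sum, Finset.sum_eq_single_of_mem m hm fun n _ hn => hv hn.symm,
    real_inner_self_eq_norm_sq]

/-- Pythagoras identifies the Cauchy criterion for the vectors with that for their squared norms. -/
theorem summable_of_pairwise_inner_eq_zero [CompleteSpace E] {v : ι → E}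
    (hv : Pairwise fun m n => inner ℝ (v m) (v n) = 0) (hs : Summable fun n => ‖v n‖ ^ 2) :
    Summable v := by
  rw [summable_iff_vanishing_norm]
  intro ε hε
  obtain ⟨s, h⟩ := summable_iff_vanishing_norm.1 hs (ε ^ 2) (by positivity)
  refine ⟨s, fun t ht => lt_of_pow_lt_pow_left₀ 2 hε.le ?_⟩
  rw [norm_sum_sq_of_pairwise_inner_eq_zero hv]
  exact (le_abs_self _).trans_lt (h t ht)

end OrthogonalSeries

/-! ### The stochastic integral -/

section StochasticIntegral

variable {Ω : Type*} [MeasurableSpace Ω] {P : Measure Ω} {H T : ℝ}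
  {ι Y : Type*} [NormedAddCommGroup Y] [InnerProductSpace ℝ Y] (B : QFBM H T P ι Y)
  {X : Type*} [NormedAddCommGroup X] [InnerProductSpace ℝ X]

/-- Increments are measurable functions of the independent paths, so the expectation factorises into
means, and the processes are centred. -/
theorem QFBM.integral_increment_mul_eq_zero {m n : ι} (hmn : m ≠ n) {a b c d : ℝ}
    (ha : a ∈ Icc 0 T) (hb : b ∈ Icc 0 T) (hc : c ∈ Icc 0 T) (hd : d ∈ Icc 0 T) :
    ∫ ω, (B.β m b ω - B.β m a ω) * (B.β n d ω - B.β n c ω) ∂P = 0 := by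
  have hmeas : ∀ s t : Icc (0 : ℝ) T, Measurable fun x : Icc (0 : ℝ) T → ℝ => x t - x s :=
    fun s t => (measurable_pi_apply t).sub (measurable_pi_apply s)
  have hind := (B.indep.indepFun hmn).comp (hmeas ⟨a, ha⟩ ⟨b, hb⟩) (hmeas ⟨c, hc⟩ ⟨d, hd⟩)
  have hm : ∀ {t}, t ∈ Icc 0 T → MemLp (B.β m t) 2 P := (B.fbm m).memLp
  have hn : ∀ {t}, t ∈ Icc 0 T → MemLp (B.β n t) 2 P := (B.fbm n).memLp
  have h := hind.integral_fun_mul_eq_mul_integral ((hm hb).1.sub (hm ha).1) ((hn hd).1.sub (hn hc).1)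
  refine h.trans ?_
  have : ∫ ω, (B.β m b ω - B.β m a ω) ∂P = 0 := by
    have := (B.fbm m).gaussian.isProbabilityMeasure
    rw [integral_sub ((hm hb).integrable one_le_two) ((hm ha).integrable one_le_two),
      (B.fbm m).mean_zero b hb, (B.fbm m).mean_zero a ha, sub_zero]
  exact mul_eq_zero_of_left this _

theorem QFBM.inner_integral_eq_zero {m n : ι} (hmn : m ≠ n) (S S' : StepData X T) :
    inner ℝ (S.memLp_integral (B.fbm m)).toLp (S'.memLp_integral (B.fbm n)).toLp = 0 := by
  have hmem : ∀ (k : ι) (S : StepData X T) i,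
      MemLp (fun ω => B.β k (S.b i) ω - B.β k (S.a i) ω) 2 P := fun k S i =>
    ((B.fbm k).memLp ⟨(S.nonneg i).trans (S.le i), S.le_end i⟩).sub
      ((B.fbm k).memLp ⟨S.nonneg i, (S.le i).trans (S.le_end i)⟩)
  have hi : ∀ i j, Integrable (fun ω => inner ℝ (S.c i) (S'.c j) *
      ((B.β m (S.b i) ω - B.β m (S.a i) ω) * (B.β n (S'.b j) ω - B.β n (S'.a j) ω))) P :=
    fun i j => ((hmem m S i).integrable_mul (hmem n S' j)).const_mul _
  rw [L2.inner_def]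
  calc _ = ∫ ω, ∑ i, ∑ j, inner ℝ (S.c i) (S'.c j) *
      ((B.β m (S.b i) ω - B.β m (S.a i) ω) * (B.β n (S'.b j) ω - B.β n (S'.a j) ω)) ∂P := by
        refine integral_congr_ae ?_
        filter_upwards [(S.memLp_integral (B.fbm m)).coeFn_toLp,
          (S'.memLp_integral (B.fbm n)).coeFn_toLp] with ω h1 h2
        rw [h1, h2, StepData.integral, StepData.integral, sum_inner]
        refine Finset.sum_congr rfl fun i _ => ?_
        rw [inner_sum]
        refine Finset.sum_congr rfl fun j _ => ?_
        rw [real_inner_smul_left, real_inner_smul_right]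
        ring
    _ = 0 := by
        rw [integral_finsetSum _ fun i _ => integrable_finsetSum _ fun j _ => hi i j]
        refine Finset.sum_eq_zero fun i _ => ?_
        rw [integral_finsetSum _ fun j _ => hi i j]
        refine Finset.sum_eq_zero fun j _ => ?_
        rw [integral_const_mul, B.integral_increment_mul_eq_zero hmn
          ⟨S.nonneg i, (S.le i).trans (S.le_end i)⟩ ⟨(S.nonneg i).trans (S.le i), S.le_end i⟩
          ⟨S'.nonneg j, (S'.le j).trans (S'.le_end j)⟩
          ⟨(S'.nonneg j).trans (S'.le j), S'.le_end j⟩, mul_zero]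

variable [CompleteSpace X]

theorem QFBM.inner_wienerMap_eq_zero (hH : H ∈ Ioo (1 / 2 : ℝ) 1) (hT : 0 ≤ T) {m n : ι}
    (hmn : m ≠ n) (f g : Lp X 2 (timeMeasure T)) :
    inner ℝ (wienerMap T P (B.β m) X f) (wienerMap T P (B.β n) X g) = 0 := by
  obtain ⟨S, hS⟩ := exists_stepData_tendsto_toLp hT f
  obtain ⟨S', hS'⟩ := exists_stepData_tendsto_toLp hT g
  have h := (((wienerMap T P (B.β m) X).continuous.tendsto f).comp hS).inner (𝕜 := ℝ)
    (((wienerMap T P (B.β n) X).continuous.tendsto g).comp hS')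
  refine tendsto_nhds_unique h ?_
  simp only [Function.comp_apply, wienerMap_toLp hH hT (B.fbm _), B.inner_integral_eq_zero hmn]
  exact tendsto_const_nhds

/-- Two stochastic integrals are as close as their integrands are in `L²([0,T], 𝓛₂⁰)`. -/
theorem QFBM.IsStochasticIntegral.ofReal_norm_sub_sq_le {B : QFBM H T P ι Y}
    (hH : H ∈ Ioo (1 / 2 : ℝ) 1)
    {t t' : ℝ} (ht : t ∈ Icc 0 T) (ht' : t' ∈ Icc 0 T) {Φ Φ' : ℝ → Y →L[ℝ] X}
    (hΦ : ∀ n, MemLp (fun s => √(B.lam n) • Φ s (B.e n)) 2 (timeMeasure t))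
    (hΦ' : ∀ n, MemLp (fun s => √(B.lam n) • Φ' s (B.e n)) 2 (timeMeasure t'))
    {Z Z' : Lp X 2 P} (hZ : B.IsStochasticIntegral t Φ Z) (hZ' : B.IsStochasticIntegral t' Φ' Z') :
    ENNReal.ofReal (‖Z - Z'‖ ^ 2) ≤ ENNReal.ofReal (wienerBound H T ^ 2) *
      ∑' n, eLpNorm ((Icc 0 t).indicator (fun s => √(B.lam n) • Φ s (B.e n)) -
        (Icc 0 t').indicator (fun s => √(B.lam n) • Φ' s (B.e n))) 2 (timeMeasure T) ^ 2 := by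
  have hT : 0 ≤ T := ht.1.trans ht.2
  obtain ⟨I, hI, hIZ⟩ := hZ
  obtain ⟨I', hI', hIZ'⟩ := hZ'
  have hsum := hIZ.sub hIZ'
  have hsub : ∀ n, I n - I' n = wienerMap T P (B.β n) X
      ((memLp_indicator_timeMeasure ht.2 (hΦ n)).sub
        (memLp_indicator_timeMeasure ht'.2 (hΦ' n))).toLp := fun n => by
    rw [(isWienerIntegral_iff hH (B.fbm n) ht (hΦ n) _).1 (hI n),
      (isWienerIntegral_iff hH (B.fbm n) ht' (hΦ' n) _).1 (hI' n), ← map_sub, MemLp.toLp_sub]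
  have horth : Pairwise fun m n => inner ℝ (I m - I' m) (I n - I' n) = 0 := fun m n hmn => by
    simp only [hsub]
    exact B.inner_wienerMap_eq_zero hH hT hmn _ _
  -- Finite partial sums are estimated by orthogonality with a bound independent of the finite set,
  -- and the estimate passes to the limit.
  refine le_of_tendsto (ENNReal.tendsto_ofReal (Tendsto.pow (Tendsto.norm hsum) 2))
    (Eventually.of_forall fun F => ?_)
  rw [norm_sum_sq_of_pairwise_inner_eq_zero horth,
    ENNReal.ofReal_sum_of_nonneg fun n _ => sq_nonneg _]
  refine (Finset.sum_le_sum fun n _ => ?_).trans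
    ((Finset.mul_sum _ _ _).ge.trans (mul_le_mul_right (ENNReal.sum_le_tsum F) _))
  rw [hsub]
  have h := norm_wienerMap_le hH hT (B.fbm n) ((memLp_indicator_timeMeasure ht.2 (hΦ n)).sub
        (memLp_indicator_timeMeasure ht'.2 (hΦ' n))).toLp
  rw [Lp.norm_toLp] at h
  have hfin := ((memLp_indicator_timeMeasure ht.2 (hΦ n)).sub
        (memLp_indicator_timeMeasure ht'.2 (hΦ' n))).eLpNorm_ne_top
  refine (ENNReal.ofReal_le_ofReal (pow_le_pow_left₀ (norm_nonneg _) h 2)).trans_eq ?_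
  rw [mul_pow, ENNReal.ofReal_mul (sq_nonneg _), ENNReal.ofReal_pow ENNReal.toReal_nonneg,
    ENNReal.ofReal_toReal hfin]

theorem QFBM.IsStochasticIntegral.unique {B : QFBM H T P ι Y} (hH : H ∈ Ioo (1 / 2 : ℝ) 1)
    {t : ℝ} (ht : t ∈ Icc 0 T) {Φ : ℝ → Y →L[ℝ] X}
    (hΦ : ∀ n, MemLp (fun s => √(B.lam n) • Φ s (B.e n)) 2 (timeMeasure t))
    {Z Z' : Lp X 2 P} (hZ : B.IsStochasticIntegral t Φ Z) (hZ' : B.IsStochasticIntegral t Φ Z') :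
    Z = Z' := by
  have h := hZ.ofReal_norm_sub_sq_le hH ht ht hΦ hΦ hZ'
  simp only [sub_self, eLpNorm_zero, ne_eq, OfNat.ofNat_ne_zero, not_false_eq_true, zero_pow,
    tsum_zero, mul_zero, nonpos_iff_eq_zero, ENNReal.ofReal_eq_zero] at h
  exact sub_eq_zero.1 (norm_eq_zero.1 (pow_eq_zero_iff two_ne_zero |>.1 (le_antisymm h
    (sq_nonneg _))))

theorem QFBM.exists_isStochasticIntegral (hH : H ∈ Ioo (1 / 2 : ℝ) 1)
    {t : ℝ} (ht : t ∈ Icc 0 T) {Φ : ℝ → Y →L[ℝ] X}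
    (hΦ : ∀ n, MemLp (fun s => √(B.lam n) • Φ s (B.e n)) 2 (timeMeasure t))
    (hsum : ∑' n, eLpNorm (fun s => √(B.lam n) • Φ s (B.e n)) 2 (timeMeasure t) ^ 2 ≠ ∞) :
    ∃ Z : Lp X 2 P, B.IsStochasticIntegral t Φ Z := by
  have hT : 0 ≤ T := ht.1.trans ht.2
  let F := fun n => (memLp_indicator_timeMeasure ht.2 (hΦ n)).toLp
  have hs : Summable fun n => ‖wienerMap T P (B.β n) X (F n)‖ ^ 2 := by
    refine Summable.of_nonneg_of_le (fun n => sq_nonneg _) (fun n => pow_le_pow_left₀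
      (norm_nonneg _) (norm_wienerMap_le hH hT (B.fbm n) (F n)) 2) ?_
    simp_rw [mul_pow]
    refine (((ENNReal.summable_toReal hsum).congr fun n => ?_)).mul_left _
    rw [Lp.norm_toLp, eLpNorm_indicator_timeMeasure ht.2, ENNReal.toReal_pow]
  exact ⟨_, _, fun n => (isWienerIntegral_iff hH (B.fbm n) ht (hΦ n) _).2 rfl,
    (summable_of_pairwise_inner_eq_zero
      (fun m n hmn => B.inner_wienerMap_eq_zero hH hT hmn _ _) hs).hasSum⟩

end StochasticIntegral

/-! ### The stochastic convolution -/

section StochasticConvolution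

theorem eLpNorm_two_sq_eq_lintegral {S E : Type*} [MeasurableSpace S] [NormedAddCommGroup E]
    (f : S → E) (μ : Measure S) : eLpNorm f 2 μ ^ 2 = ∫⁻ s, ‖f s‖ₑ ^ 2 ∂μ := by
  rw [eLpNorm_eq_lintegral_rpow_enorm_toReal (by norm_num) (by norm_num), ← ENNReal.rpow_natCast,
    ← ENNReal.rpow_mul]
  norm_num

variable {Ω : Type*} [MeasurableSpace Ω] {P : Measure Ω} {H T : ℝ}
  {ι Y : Type*} [NormedAddCommGroup Y] [InnerProductSpace ℝ Y] {B : QFBM H T P ι Y}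
  {X : Type*} [NormedAddCommGroup X] [InnerProductSpace ℝ X]
  {U : ℝ → ℝ → X →L[ℝ] X} {M : ℝ} {σ : ℝ → Y →L[ℝ] X} {L : ℝ}

theorem QFBM.tsum_le_of_qNorm_le {ψ : Y →L[ℝ] X} (hL : 0 ≤ L) (h : B.qNorm ψ ≤ L) :
    ∑' n, ‖√(B.lam n) • ψ (B.e n)‖ ^ 2 ≤ L ^ 2 :=
  (Real.sqrt_le_left hL).1 h

theorem QFBM.tsum_enorm_sq_le {ψ : Y →L[ℝ] X} (hL : 0 ≤ L) (hs : B.IsQHilbertSchmidt ψ)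
    (h : B.qNorm ψ ≤ L) :
    ∑' n, ‖√(B.lam n) • ψ (B.e n)‖ₑ ^ 2 ≤ ENNReal.ofReal (L ^ 2) := by
  refine le_trans (le_of_eq ?_) (ENNReal.ofReal_le_ofReal (QFBM.tsum_le_of_qNorm_le hL h))
  rw [ENNReal.ofReal_tsum_of_nonneg (fun n => sq_nonneg _) hs]
  refine tsum_congr fun n => ?_
  rw [ENNReal.ofReal_pow (norm_nonneg _), ofReal_norm]

theorem enorm_apply_sq_le (V : X →L[ℝ] X) (hV : ‖V‖ ≤ M) (x : X) :
    ‖V x‖ₑ ^ 2 ≤ ENNReal.ofReal (M ^ 2) * ‖x‖ₑ ^ 2 := by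
  have hM : 0 ≤ M := (norm_nonneg _).trans hV
  rw [ENNReal.ofReal_pow hM, ← mul_pow]
  gcongr
  rw [← ofReal_norm, ← ofReal_norm, ← ENNReal.ofReal_mul hM]
  exact ENNReal.ofReal_le_ofReal ((V.le_opNorm x).trans (by gcongr))

variable (hU : IsEvolutionFamily T U) (hM : ∀ s t, 0 ≤ s → s ≤ t → t ≤ T → ‖U t s‖ ≤ M)
  (hσm : ∀ n, AEStronglyMeasurable (fun s => √(B.lam n) • σ s (B.e n)) (timeMeasure T))
  (hL : 0 ≤ L) (hσ : ∀ t ∈ Icc 0 T, B.IsQHilbertSchmidt (σ t) ∧ B.qNorm (σ t) ≤ L)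

include hU hσm in
theorem aestronglyMeasurable_evolution_comp {t : ℝ} (ht : t ∈ Icc 0 T) (n : ι) :
    AEStronglyMeasurable (fun s => √(B.lam n) • ((U t s).comp (σ s)) (B.e n)) (timeMeasure t) := by
  have := hU.aestronglyMeasurable_apply ht
    ((hσm n).mono_measure (Measure.restrict_mono (Icc_subset_Icc_right ht.2) le_rfl))
  simpa only [map_smul, ContinuousLinearMap.comp_apply] using this

include hM hL hσ in
theorem tsum_enorm_sq_evolution_comp_le {s t : ℝ} (hs : 0 ≤ s) (hst : s ≤ t) (htT : t ≤ T) :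
    ∑' n, ‖√(B.lam n) • ((U t s).comp (σ s)) (B.e n)‖ₑ ^ 2 ≤ ENNReal.ofReal ((M * L) ^ 2) := by
  have hσs := hσ s ⟨hs, hst.trans htT⟩
  rw [mul_pow, ENNReal.ofReal_mul (sq_nonneg _)]
  refine le_trans ?_ (mul_le_mul_right (QFBM.tsum_enorm_sq_le hL hσs.1 hσs.2) _)
  rw [← ENNReal.tsum_mul_left]
  refine ENNReal.tsum_le_tsum fun n => ?_
  rw [ContinuousLinearMap.comp_apply, ← map_smul]
  exact enorm_apply_sq_le _ (hM s t hs hst htT) _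

include hU hM hσm hL hσ

theorem memLp_evolution_comp {t : ℝ} (ht : t ∈ Icc 0 T) (n : ι) :
    MemLp (fun s => √(B.lam n) • ((U t s).comp (σ s)) (B.e n)) 2 (timeMeasure t) := by
  refine MemLp.of_bound (aestronglyMeasurable_evolution_comp hU hσm ht n) |M * L| ?_
  filter_upwards [ae_restrict_mem measurableSet_Icc] with s hs
  have h := (ENNReal.le_tsum n).trans (tsum_enorm_sq_evolution_comp_le hM hL hσ hs.1 hs.2 ht.2)
  rw [← ofReal_norm, ← ENNReal.ofReal_pow (norm_nonneg _),
    ENNReal.ofReal_le_ofReal_iff (sq_nonneg _)] at h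
  simpa using sq_le_sq.1 h

variable [Countable ι]

theorem tsum_eLpNorm_evolution_comp_ne_top {t : ℝ} (ht : t ∈ Icc 0 T) :
    ∑' n, eLpNorm (fun s => √(B.lam n) • ((U t s).comp (σ s)) (B.e n)) 2 (timeMeasure t) ^ 2
      ≠ ∞ := by
  simp_rw [eLpNorm_two_sq_eq_lintegral]
  rw [← lintegral_tsum fun n =>
    (aestronglyMeasurable_evolution_comp hU hσm ht n).enorm.pow_const 2]
  refine ne_top_of_le_ne_top (b := ∫⁻ _ in Icc 0 t, ENNReal.ofReal ((M * L) ^ 2)) ?_ ?_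
  · simp [ENNReal.mul_eq_top]
  · exact setLIntegral_mono' measurableSet_Icc fun s hs =>
      tsum_enorm_sq_evolution_comp_le hM hL hσ hs.1 hs.2 ht.2

variable [CompleteSpace X]

/-- The `L²` distance of two values is controlled by the time integral of the squared
Hilbert–Schmidt distance of the integrands extended by zero. Dominated convergence is applied twice:
to the sum over `n` at fixed `s`, where the Hilbert–Schmidt property supplies a summable bound, and
then to the integral over `s`, where the bound is constant. -/
theorem continuousOn_of_isStochasticIntegral_evolution (hH : H ∈ Ioo (1 / 2 : ℝ) 1)
    {Z : ℝ → Lp X 2 P}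
    (hZ : ∀ t ∈ Icc 0 T, B.IsStochasticIntegral t (fun s => (U t s).comp (σ s)) (Z t)) :
    ContinuousOn Z (Icc 0 T) := by
  intro t₀ ht₀
  let ψ : ℝ → ι → ℝ → X := fun t n =>
    (Icc 0 t).indicator fun s => √(B.lam n) • ((U t s).comp (σ s)) (B.e n)
  have hψm : ∀ t ∈ Icc 0 T, ∀ n, AEStronglyMeasurable (ψ t n) (timeMeasure T) := fun t ht n =>
    (memLp_indicator_timeMeasure ht.2 (memLp_evolution_comp hU hM hσm hL hσ ht n)).1
  have hbound : ∀ t ∈ Icc 0 T, ∀ s ∈ Icc 0 T, ∀ n,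
      ‖ψ t n s‖ ≤ M * ‖√(B.lam n) • σ s (B.e n)‖ := by
    intro t ht s hs n
    by_cases h : s ∈ Icc 0 t
    · simp only [ψ, indicator_of_mem h]
      rw [ContinuousLinearMap.comp_apply, ← map_smul]
      exact ((U t s).le_opNorm _).trans (by gcongr; exact hM s t h.1 h.2 ht.2)
    · simp only [ψ, indicator_of_notMem h, norm_zero]
      have := (norm_nonneg _).trans (hM s s hs.1 le_rfl hs.2)
      positivity
  have hbound2 : ∀ t ∈ Icc 0 T, ∀ s ∈ Icc 0 T, ∀ n,
      ‖ψ t n s - ψ t₀ n s‖ ^ 2 ≤ (2 * M) ^ 2 * ‖√(B.lam n) • σ s (B.e n)‖ ^ 2 := by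
    intro t ht s hs n
    rw [← mul_pow]
    refine pow_le_pow_left₀ (norm_nonneg _) ?_ 2
    linarith [norm_sub_le (ψ t n s) (ψ t₀ n s), hbound t ht s hs n, hbound t₀ ht₀ s hs n]
  have hmain : Tendsto (fun t => ∫⁻ s, ∑' n, ‖ψ t n s - ψ t₀ n s‖ₑ ^ 2 ∂timeMeasure T)
      (𝓝[Icc 0 T] t₀) (𝓝 (∫⁻ _, 0 ∂timeMeasure T)) := by
    refine tendsto_lintegral_filter_of_dominated_convergence'
      (fun _ => ENNReal.ofReal ((2 * M) ^ 2) * ENNReal.ofReal (L ^ 2)) ?_ ?_ ?_ ?_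
    · filter_upwards [self_mem_nhdsWithin] with t ht
      exact AEMeasurable.tsum fun n =>
        ((hψm t ht n).sub (hψm t₀ ht₀ n)).enorm.pow_const 2
    · filter_upwards [self_mem_nhdsWithin] with t ht
      filter_upwards [ae_restrict_mem measurableSet_Icc] with s hs
      refine le_trans ?_ (mul_le_mul_right
        (QFBM.tsum_enorm_sq_le hL (hσ s hs).1 (hσ s hs).2) _)
      rw [← ENNReal.tsum_mul_left]
      refine ENNReal.tsum_le_tsum fun n => ?_
      rw [← ofReal_norm, ← ofReal_norm, ← ENNReal.ofReal_pow (norm_nonneg _),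
        ← ENNReal.ofReal_pow (norm_nonneg _), ← ENNReal.ofReal_mul (sq_nonneg _)]
      exact ENNReal.ofReal_le_ofReal (hbound2 t ht s hs n)
    · rw [lintegral_const]
      exact ENNReal.mul_ne_top (by finiteness) (measure_ne_top _ _)
    · have hne : ∀ᵐ s ∂timeMeasure T, s ≠ t₀ := ae_restrict_of_ae (by simp [ae_iff])
      filter_upwards [ae_restrict_mem measurableSet_Icc, hne] with s hs hst
      have hpt : ∀ n, Tendsto (fun t => ψ t n s) (𝓝[Icc 0 T] t₀) (𝓝 (ψ t₀ n s)) := by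
        intro n
        have h := hU.tendsto_indicator_apply hs ht₀ hst fun s => √(B.lam n) • σ s (B.e n)
        simpa only [ψ, map_smul, ContinuousLinearMap.comp_apply] using h
      have hreal : Tendsto (fun t => ∑' n, ‖ψ t n s - ψ t₀ n s‖ ^ 2) (𝓝[Icc 0 T] t₀)
          (𝓝 (∑' _ : ι, (0 : ℝ))) := by
        refine tendsto_tsum_of_dominated_convergence
          (bound := fun n => (2 * M) ^ 2 * ‖√(B.lam n) • σ s (B.e n)‖ ^ 2)
          ((hσ s hs).1.mul_left _) (fun n => ?_) ?_
        · have := (((hpt n).sub_const (ψ t₀ n s)).norm.pow 2)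
          simpa using this
        · filter_upwards [self_mem_nhdsWithin] with t ht n
          rw [Real.norm_of_nonneg (sq_nonneg _)]
          exact hbound2 t ht s hs n
      have h3 := ENNReal.tendsto_ofReal hreal
      rw [tsum_zero, ENNReal.ofReal_zero] at h3
      refine h3.congr' ?_
      filter_upwards [self_mem_nhdsWithin] with t ht
      rw [ENNReal.ofReal_tsum_of_nonneg (fun n => sq_nonneg _)
        (Summable.of_nonneg_of_le (fun n => sq_nonneg _) (hbound2 t ht s hs)
          ((hσ s hs).1.mul_left _))]
      refine tsum_congr fun n => ?_
      rw [ENNReal.ofReal_pow (norm_nonneg _), ofReal_norm]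
  rw [lintegral_zero] at hmain
  have h0 : Tendsto (fun t => ENNReal.ofReal (‖Z t - Z t₀‖ ^ 2)) (𝓝[Icc 0 T] t₀) (𝓝 0) := by
    have h1 := ENNReal.Tendsto.const_mul (a := ENNReal.ofReal (wienerBound H T ^ 2)) hmain
      (Or.inr ENNReal.ofReal_ne_top)
    rw [mul_zero] at h1
    refine tendsto_of_tendsto_of_tendsto_of_le_of_le' tendsto_const_nhds h1
      (Eventually.of_forall fun _ => zero_le) ?_
    filter_upwards [self_mem_nhdsWithin] with t ht
    refine ((hZ t ht).ofReal_norm_sub_sq_le hH ht ht₀ (memLp_evolution_comp hU hM hσm hL hσ ht)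
      (memLp_evolution_comp hU hM hσm hL hσ ht₀) (hZ t₀ ht₀)).trans_eq ?_
    simp_rw [eLpNorm_two_sq_eq_lintegral]
    rw [← lintegral_tsum fun n => ((hψm t ht n).sub (hψm t₀ ht₀ n)).enorm.pow_const 2]
    rfl
  have h1 := (ENNReal.tendsto_toReal ENNReal.zero_ne_top).comp h0
  simp only [Function.comp_def, ENNReal.toReal_zero, ENNReal.toReal_ofReal (sq_nonneg _)] at h1
  have h2 := h1.sqrt
  simp only [Real.sqrt_sq (norm_nonneg _), Real.sqrt_zero] at h2
  exact tendsto_iff_norm_sub_tendsto_zero.2 h2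

end StochasticConvolution

/-! ### Deterministic convolutions with an evolution family -/

section Convolution

variable {E : Type*} [NormedAddCommGroup E] [NormedSpace ℝ E] {T M C : ℝ}
  {V : ℝ → ℝ → E →L[ℝ] E}

theorem norm_evolution_apply_le (hM : ∀ s t, 0 ≤ s → s ≤ t → t ≤ T → ‖V t s‖ ≤ M) {s t : ℝ}
    (hs : 0 ≤ s) (hst : s ≤ t) (htT : t ≤ T) {x : E} {D : ℝ} (hx : ‖x‖ ≤ D) :
    ‖V t s x‖ ≤ M * D :=
  ((V t s).le_opNorm x).trans
    (mul_le_mul (hM s t hs hst htT) hx (norm_nonneg _) ((norm_nonneg _).trans (hM s t hs hst htT)))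

theorem intervalIntegrable_evolution_apply (hM : ∀ s t, 0 ≤ s → s ≤ t → t ≤ T → ‖V t s‖ ≤ M)
    {h : ℝ → E} (hC : ∀ s ∈ Icc 0 T, ‖h s‖ ≤ C) {t : ℝ} (ht : t ∈ Icc 0 T)
    (hm : AEStronglyMeasurable (fun s => V t s (h s)) (timeMeasure t)) :
    IntervalIntegrable (fun s => V t s (h s)) volume 0 t := by
  rw [intervalIntegrable_iff_integrableOn_Icc_of_le ht.1]
  refine Integrable.of_bound hm (M * C) ?_
  filter_upwards [ae_restrict_mem measurableSet_Icc] with s hs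
  exact norm_evolution_apply_le hM hs.1 hs.2 ht.2 (hC s ⟨hs.1, hs.2.trans ht.2⟩)

theorem intervalIntegral_eq_integral_indicator {t : ℝ} (ht : t ∈ Icc 0 T) (u : ℝ → E) :
    ∫ s in (0 : ℝ)..t, u s = ∫ s, (Icc 0 t).indicator u s ∂timeMeasure T := by
  rw [integral_indicator measurableSet_Icc, Measure.restrict_restrict measurableSet_Icc,
    inter_eq_left.2 (Icc_subset_Icc_right ht.2), intervalIntegral.integral_of_le ht.1,
    integral_Icc_eq_integral_Ioc]

/-- With the moving end point absorbed into an indicator, this is dominated convergence; no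
continuity of `h` is needed. -/
theorem continuousOn_integral_evolution_apply [CompleteSpace E] (hV : IsEvolutionFamily T V)
    (hM : ∀ s t, 0 ≤ s → s ≤ t → t ≤ T → ‖V t s‖ ≤ M) {h : ℝ → E}
    (hC : ∀ s ∈ Icc 0 T, ‖h s‖ ≤ C)
    (hm : ∀ t ∈ Icc 0 T, AEStronglyMeasurable (fun s => V t s (h s)) (timeMeasure t)) :
    ContinuousOn (fun t => ∫ s in (0 : ℝ)..t, V t s (h s)) (Icc 0 T) := by
  refine ContinuousOn.congr (f := fun t =>
    ∫ s, (Icc 0 t).indicator (fun s => V t s (h s)) s ∂timeMeasure T) ?_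
    fun t ht => intervalIntegral_eq_integral_indicator ht _
  intro t₀ ht₀
  refine tendsto_integral_filter_of_dominated_convergence (fun _ => M * C) ?_ ?_
    (integrable_const _) ?_
  · filter_upwards [self_mem_nhdsWithin] with t ht
    rw [aestronglyMeasurable_indicator_iff measurableSet_Icc,
      Measure.restrict_restrict measurableSet_Icc, inter_eq_left.2 (Icc_subset_Icc_right ht.2)]
    exact hm t ht
  · filter_upwards [self_mem_nhdsWithin] with t ht
    filter_upwards [ae_restrict_mem measurableSet_Icc] with s hs
    have hMC : 0 ≤ M * C := mul_nonneg ((norm_nonneg _).trans (hM s s hs.1 le_rfl hs.2))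
      ((norm_nonneg _).trans (hC s hs))
    by_cases hst : s ∈ Icc 0 t
    · rw [indicator_of_mem hst]
      exact norm_evolution_apply_le hM hst.1 hst.2 ht.2 (hC s hs)
    · rwa [indicator_of_notMem hst, norm_zero]
  · have hne : ∀ᵐ s ∂timeMeasure T, s ≠ t₀ := ae_restrict_of_ae (by simp [ae_iff])
    filter_upwards [ae_restrict_mem measurableSet_Icc, hne] with s hs hst
    exact hV.tendsto_indicator_apply hs ht₀ hst h

theorem integral_exp_mul_le {l : ℝ} (hl : 0 < l) (t : ℝ) :
    ∫ s in (0 : ℝ)..t, Real.exp (l * s) ≤ Real.exp (l * t) / l := by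
  rw [intervalIntegral.integral_comp_mul_left (fun s => Real.exp s) hl.ne', integral_exp,
    smul_eq_mul, ← div_eq_inv_mul]
  gcongr
  linarith [Real.exp_pos (l * 0)]

/-- Integrating the exponential weight gains the factor `1 / l`, which makes integral terms small
whatever their Lipschitz constants are. -/
theorem norm_integral_sub_integral_le (hM : ∀ s t, 0 ≤ s → s ≤ t → t ≤ T → ‖V t s‖ ≤ M)
    {h h' : ℝ → E} {t : ℝ} (ht : t ∈ Icc 0 T)
    (hi : IntervalIntegrable (fun s => V t s (h s)) volume 0 t)
    (hi' : IntervalIntegrable (fun s => V t s (h' s)) volume 0 t) {D l : ℝ} (hl : 0 < l)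
    (hD : 0 ≤ D) (hh : ∀ s ∈ Icc 0 T, ‖h s - h' s‖ ≤ D * Real.exp (l * s)) :
    ‖(∫ s in (0 : ℝ)..t, V t s (h s)) - ∫ s in (0 : ℝ)..t, V t s (h' s)‖ ≤
      M * D / l * Real.exp (l * t) := by
  rw [← intervalIntegral.integral_sub hi hi']
  have hM0 : 0 ≤ M := (norm_nonneg _).trans (hM t t ht.1 le_rfl ht.2)
  calc _ ≤ ∫ s in (0 : ℝ)..t, M * D * Real.exp (l * s) := by
        refine intervalIntegral.norm_integral_le_of_norm_le ht.1 (ae_of_all _ fun s hs => ?_)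
          ((by fun_prop : Continuous fun s => M * D * Real.exp (l * s)).intervalIntegrable _ _)
        rw [← map_sub, mul_assoc]
        exact norm_evolution_apply_le hM hs.1.le hs.2 ht.2 (hh s ⟨hs.1.le, hs.2.trans ht.2⟩)
    _ = M * D * ∫ s in (0 : ℝ)..t, Real.exp (l * s) := intervalIntegral.integral_const_mul _ _
    _ ≤ M * D * (Real.exp (l * t) / l) := by
        gcongr
        exact integral_exp_mul_le hl t
    _ = _ := by ring

end Convolution

/-! ### Neutral equations driven by a continuous function -/

section Neutral

variable {E : Type*} [NormedAddCommGroup E]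

/-- The right-hand side of the mild formulation of a neutral equation in a Banach space. -/
noncomputable def neutralMap [NormedSpace ℝ E] (V : ℝ → ℝ → E →L[ℝ] E) (G K F : ℝ → E → E) (r ρ : ℝ → ℝ) (Z : ℝ → E)
    (ξ : E) (x : ℝ → E) (t : ℝ) : E :=
  V t 0 ξ - G t (x (t - r t)) - (∫ s in (0 : ℝ)..t, V t s (K s (x (s - r s))))
    + (∫ s in (0 : ℝ)..t, V t s (F s (x (s - ρ s)))) + Z t

theorem continuousOn_comp_delay {x : ℝ → E} {r : ℝ → ℝ} {τ T : ℝ}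
    (hx : ContinuousOn x (Icc (-τ) T)) (hr : ContinuousOn r (Icc 0 T))
    (hrτ : ∀ t ∈ Icc 0 T, t - r t ∈ Icc (-τ) t) :
    ContinuousOn (fun t => x (t - r t)) (Icc 0 T) :=
  hx.comp (continuousOn_id.sub hr) fun t ht => ⟨(hrτ t ht).1, (hrτ t ht).2.trans ht.2⟩

theorem exists_bound_of_lipschitz {T : ℝ} {K : ℝ → E → E} {k C : ℝ} (hk : 0 ≤ k)
    (hK : ∀ t ∈ Icc 0 T, ∀ x y, ‖K t x - K t y‖ ≤ k * ‖x - y‖)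
    (hC : ∀ t ∈ Icc 0 T, ‖K t 0‖ ≤ C) {z : ℝ → E} (hz : ContinuousOn z (Icc 0 T)) :
    ∃ D, ∀ t ∈ Icc 0 T, ‖K t (z t)‖ ≤ D := by
  obtain ⟨D, hD⟩ := isCompact_Icc.exists_bound_of_continuousOn hz
  refine ⟨k * D + C, fun t ht => ?_⟩
  have h1 := hK t ht (z t) 0
  rw [sub_zero] at h1
  calc ‖K t (z t)‖ = ‖(K t (z t) - K t 0) + K t 0‖ := by rw [sub_add_cancel]
    _ ≤ ‖K t (z t) - K t 0‖ + ‖K t 0‖ := norm_add_le _ _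
    _ ≤ k * D + C := add_le_add (h1.trans (by gcongr; exact hD t ht)) (hC t ht)

/-- Only `G` must have Lipschitz constant below one, since no choice of weight can shrink a term
evaluated at a possibly undelayed time. Measurability is asked of the products `V t s (K s (z s))`
because `K` alone need not be known to be measurable in time. -/
theorem exists_unique_neutral [NormedSpace ℝ E] [CompleteSpace E] {T M τ : ℝ} {V : ℝ → ℝ → E →L[ℝ] E}
    {G K F : ℝ → E → E} {r ρ : ℝ → ℝ} {Z φ : ℝ → E} (hT : 0 ≤ T) (hτ : 0 ≤ τ)
    (hV : IsEvolutionFamily T V) (hM : ∀ s t, 0 ≤ s → s ≤ t → t ≤ T → ‖V t s‖ ≤ M)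
    {kG kK kF CK CF : ℝ} (hkG0 : 0 ≤ kG) (hkG1 : kG < 1) (hkK0 : 0 ≤ kK) (hkF0 : 0 < kF)
    (hG : ∀ t ∈ Icc 0 T, ∀ x y, ‖G t x - G t y‖ ≤ kG * ‖x - y‖)
    (hK : ∀ t ∈ Icc 0 T, ∀ x y, ‖K t x - K t y‖ ≤ kK * ‖x - y‖)
    (hF : ∀ t ∈ Icc 0 T, ∀ x y, ‖F t x - F t y‖ ≤ kF * ‖x - y‖)
    (hGc : ∀ z, ContinuousOn z (Icc 0 T) → ContinuousOn (fun t => G t (z t)) (Icc 0 T))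
    (hCK : ∀ t ∈ Icc 0 T, ‖K t 0‖ ≤ CK) (hCF : ∀ t ∈ Icc 0 T, ‖F t 0‖ ≤ CF)
    (hKm : ∀ z, ContinuousOn z (Icc 0 T) → ∀ t ∈ Icc 0 T,
      AEStronglyMeasurable (fun s => V t s (K s (z s))) (timeMeasure t))
    (hFm : ∀ z, ContinuousOn z (Icc 0 T) → ∀ t ∈ Icc 0 T,
      AEStronglyMeasurable (fun s => V t s (F s (z s))) (timeMeasure t))
    (hr : ContinuousOn r (Icc 0 T)) (hρ : ContinuousOn ρ (Icc 0 T))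
    (hrτ : ∀ t ∈ Icc 0 T, t - r t ∈ Icc (-τ) t) (hρτ : ∀ t ∈ Icc 0 T, t - ρ t ∈ Icc (-τ) t)
    (hZ : ContinuousOn Z (Icc 0 T)) (hZ0 : Z 0 = 0) (hφ : ContinuousOn φ (Icc (-τ) 0)) :
    ∃ x, (ContinuousOn x (Icc (-τ) T) ∧ (∀ t ∈ Icc (-τ) 0, x t = φ t) ∧
        ∀ t ∈ Icc 0 T, x t = neutralMap V G K F r ρ Z (φ 0 + G 0 (φ (-r 0))) x t) ∧
      ∀ y, ContinuousOn y (Icc (-τ) T) → (∀ t ∈ Icc (-τ) 0, y t = φ t) →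
        (∀ t ∈ Icc 0 T, y t = neutralMap V G K F r ρ Z (φ 0 + G 0 (φ (-r 0))) y t) →
        ∀ t ∈ Icc (-τ) T, y t = x t := by
  set ξ := φ 0 + G 0 (φ (-r 0)) with hξ
  set N := neutralMap V G K F r ρ Z ξ with hN
  have h0T : (0 : ℝ) ∈ Icc 0 T := ⟨le_rfl, hT⟩
  have hM0 : 0 ≤ M := (norm_nonneg _).trans (hM 0 0 le_rfl le_rfl hT)
  have hbK : ∀ x, ContinuousOn x (Icc (-τ) T) → ∃ D, ∀ t ∈ Icc 0 T, ‖K t (x (t - r t))‖ ≤ D :=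
    fun x hx => exists_bound_of_lipschitz hkK0 hK hCK (continuousOn_comp_delay hx hr hrτ)
  have hbF : ∀ x, ContinuousOn x (Icc (-τ) T) → ∃ D, ∀ t ∈ Icc 0 T, ‖F t (x (t - ρ t))‖ ≤ D :=
    fun x hx => exists_bound_of_lipschitz hkF0.le hF hCF (continuousOn_comp_delay hx hρ hρτ)
  have hNc : ∀ x, ContinuousOn x (Icc (-τ) T) → ContinuousOn (N x) (Icc 0 T) := by
    intro x hx
    obtain ⟨DK, hDK⟩ := hbK x hx
    obtain ⟨DF, hDF⟩ := hbF x hx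
    refine ((((?_ : ContinuousOn (fun t => V t 0 ξ) (Icc 0 T)).sub
      (hGc _ (continuousOn_comp_delay hx hr hrτ))).sub
      (continuousOn_integral_evolution_apply hV hM hDK
        (hKm _ (continuousOn_comp_delay hx hr hrτ)))).add
      (continuousOn_integral_evolution_apply hV hM hDF
        (hFm _ (continuousOn_comp_delay hx hρ hρτ)))).add hZ
    exact (hV.strongly_continuous ξ).comp (f := fun t => (t, 0)) (by fun_prop)
      fun t ht => ⟨le_rfl, ht.1, ht.2⟩
  -- The two `G` terms cancel at time zero because `-r 0` lies in `[-τ,0]`. Hence history and mild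
  -- formula agree at `0` and glue to a continuous function.
  have hN0 : ∀ x, (∀ t ∈ Icc (-τ) 0, x t = φ t) → N x 0 = φ 0 := by
    intro x hx
    have hr0 := hrτ 0 h0T
    have h1 : x (-r 0) = φ (-r 0) := by
      rw [zero_sub] at hr0
      exact hx _ hr0
    simp [hN, neutralMap, h1, hZ0, hV.self 0 h0T, hξ]
  let Γ : (ℝ → E) → ℝ → E := fun x t => if t ≤ 0 then φ t else N x t
  have hΓN : ∀ x, (∀ t ∈ Icc (-τ) 0, x t = φ t) → ∀ t ∈ Icc 0 T, Γ x t = N x t := by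
    intro x hx t ht
    by_cases h : t ≤ 0
    · obtain rfl : t = 0 := le_antisymm h ht.1
      simp only [Γ, if_pos h, hN0 x hx]
    · simp only [Γ, if_neg h]
  have hΓφ : ∀ x, ∀ t ∈ Icc (-τ) 0, Γ x t = φ t := fun x t ht => if_pos ht.2
  -- Chosen so that the integral terms use at most half of the gap `1 - kG`, leaving the contraction
  -- constant `(1 + kG) / 2`; the `+ 1` keeps `l` positive.
  set l := 2 * (M * (kK + kF) + 1) / (1 - kG) with hl
  have hk1 : 0 < 1 - kG := by linarith
  have hl0 : 0 < l := by positivity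
  have hsmall : M * kK / l + M * kF / l ≤ (1 - kG) / 2 := by
    rw [← add_div, div_le_iff₀ hl0, hl]
    field_simp
    linarith
  have hcont : ∀ x, ContinuousOn x (Icc (-τ) T) → (∀ t ∈ Icc (-τ) 0, x t = φ t) →
      ContinuousOn (Γ x) (Icc (-τ) T) ∧ ∀ t ∈ Icc (-τ) 0, Γ x t = φ t := by
    intro x hx hxφ
    refine ⟨?_, hΓφ x⟩
    rw [← Icc_union_Icc_eq_Icc (neg_nonpos.2 hτ) hT]
    exact ContinuousOn.union_of_isClosed (hφ.congr (hΓφ x)) ((hNc x hx).congr (hΓN x hxφ))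
      isClosed_Icc isClosed_Icc
  have hcontr : ∀ x y, ContinuousOn x (Icc (-τ) T) → (∀ t ∈ Icc (-τ) 0, x t = φ t) →
      ContinuousOn y (Icc (-τ) T) → (∀ t ∈ Icc (-τ) 0, y t = φ t) → ∀ D,
      (∀ s ∈ Icc (-τ) T, ‖x s - y s‖ ≤ D * Real.exp (l * s)) →
      ∀ t ∈ Icc (-τ) T, ‖Γ x t - Γ y t‖ ≤ (1 + kG) / 2 * D * Real.exp (l * t) := by
    intro x y hx hxφ hy hyφ D hD t ht
    have hD0 : 0 ≤ D := by
      have := (norm_nonneg _).trans (hD t ht)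
      exact nonneg_of_mul_nonneg_left this (Real.exp_pos _)
    rcases le_total t 0 with h | h
    · rw [hΓφ x t ⟨ht.1, h⟩, hΓφ y t ⟨ht.1, h⟩, sub_self, norm_zero]
      positivity
    have htT : t ∈ Icc 0 T := ⟨h, ht.2⟩
    -- Delays look backwards and the weight is increasing, so a delayed argument obeys the bound at
    -- the current time.
    have hdelay : ∀ {q : ℝ → ℝ}, (∀ t ∈ Icc 0 T, t - q t ∈ Icc (-τ) t) → ∀ s ∈ Icc 0 T,
        ‖x (s - q s) - y (s - q s)‖ ≤ D * Real.exp (l * s) := by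
      intro q hq s hs
      have hqs := hq s hs
      refine (hD _ ⟨hqs.1, hqs.2.trans hs.2⟩).trans ?_
      gcongr
      exact hqs.2
    have hint : ∀ (J : ℝ → E → E) (q : ℝ → ℝ) (z : ℝ → E),
        (∀ t ∈ Icc 0 T, AEStronglyMeasurable (fun s => V t s (J s (z (s - q s)))) (timeMeasure t)) →
        (∃ D, ∀ t ∈ Icc 0 T, ‖J t (z (t - q t))‖ ≤ D) →
        IntervalIntegrable (fun s => V t s (J s (z (s - q s)))) volume 0 t := by
      rintro J q z hm ⟨D, hD⟩
      exact intervalIntegrable_evolution_apply (h := fun s => J s (z (s - q s))) hM hD htT (hm t htT)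
    rw [hΓN x hxφ t htT, hΓN y hyφ t htT]
    have e1 : ‖G t (x (t - r t)) - G t (y (t - r t))‖ ≤ kG * (D * Real.exp (l * t)) :=
      (hG t htT _ _).trans (by gcongr; exact hdelay hrτ t htT)
    have e2 := norm_integral_sub_integral_le (h := fun s => K s (x (s - r s)))
      (h' := fun s => K s (y (s - r s))) hM htT
      (hint K r x (hKm _ (continuousOn_comp_delay hx hr hrτ)) (hbK x hx))
      (hint K r y (hKm _ (continuousOn_comp_delay hy hr hrτ)) (hbK y hy)) (D := kK * D) hl0
      (by positivity) fun s hs => (hK s hs _ _).trans (by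
        rw [mul_assoc]; gcongr; exact hdelay hrτ s hs)
    have e3 := norm_integral_sub_integral_le (h := fun s => F s (x (s - ρ s)))
      (h' := fun s => F s (y (s - ρ s))) hM htT
      (hint F ρ x (hFm _ (continuousOn_comp_delay hx hρ hρτ)) (hbF x hx))
      (hint F ρ y (hFm _ (continuousOn_comp_delay hy hρ hρτ)) (hbF y hy)) (D := kF * D) hl0
      (by positivity) fun s hs => (hF s hs _ _).trans (by
        rw [mul_assoc]; gcongr; exact hdelay hρτ s hs)
    have hsplit : ∀ a b₁ b₂ c₁ c₂ d₁ d₂ z : E, (a - b₁ - c₁ + d₁ + z) - (a - b₂ - c₂ + d₂ + z) =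
        -(b₁ - b₂) - (c₁ - c₂) + (d₁ - d₂) := fun a b₁ b₂ c₁ c₂ d₁ d₂ z => by abel
    rw [hN, neutralMap, neutralMap, hsplit]
    refine (norm_add_le _ _).trans ((add_le_add ((norm_sub_le _ _).trans
      (add_le_add ((norm_neg _).trans_le e1) e2)) e3).trans ?_)
    have hE : 0 ≤ D * Real.exp (l * t) := by positivity
    calc _ = (kG + (M * kK / l + M * kF / l)) * (D * Real.exp (l * t)) := by ring
      _ ≤ (kG + (1 - kG) / 2) * (D * Real.exp (l * t)) := by gcongr
      _ = _ := by ring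
  obtain ⟨x, ⟨hxc, hxφ, hxΓ⟩, huniq⟩ := exists_unique_of_weighted_contraction hT φ hφ
    (neg_nonpos.2 hτ) Γ ((1 + kG) / 2) l (by positivity) (by linarith) hcont hcontr
  refine ⟨x, ⟨hxc, hxφ, fun t ht => ?_⟩, fun y hy hyφ hyN => huniq y hy hyφ fun t ht => ?_⟩
  · rw [← hΓN x hxφ t ht, hxΓ t ⟨(neg_nonpos.2 hτ).trans ht.1, ht.2⟩]
  · rcases le_total t 0 with h | h
    · rw [hΓφ y t ⟨ht.1, h⟩, hyφ t ⟨ht.1, h⟩]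
    · rw [hΓN y hyφ t ⟨h, ht.2⟩, ← hyN t ⟨h, ht.2⟩]

end Neutral

/-! ### Lifting an evolution family and its nonlinearities to `L²(Ω, X)` -/

section Lift

variable {Ω : Type*} [MeasurableSpace Ω] {P : Measure Ω}
  {X : Type*} [NormedAddCommGroup X] [NormedSpace ℝ X] {T M K : ℝ} {U : ℝ → ℝ → X →L[ℝ] X}

theorem IsEvolutionFamily.compLpL [IsFiniteMeasure P] (hU : IsEvolutionFamily T U)
    (hM : ∀ s t, 0 ≤ s → s ≤ t → t ≤ T → ‖U t s‖ ≤ M) :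
    IsEvolutionFamily T fun t s => (U t s).compLpL 2 P where
  self s hs := by
    ext1 y
    refine Lp.ext ?_
    filter_upwards [(U s s).coeFn_compLpL (p := 2) y] with ω hω
    rw [hω, hU.self s hs]
    rfl
  comp r s t hr hrs hst ht := by
    ext1 y
    refine Lp.ext ?_
    rw [ContinuousLinearMap.comp_apply]
    filter_upwards [(U t r).coeFn_compLpL (p := 2) y, (U s r).coeFn_compLpL (p := 2) y,
      (U t s).coeFn_compLpL (p := 2) ((U s r).compLpL 2 P y)] with ω h1 h2 h3
    rw [h1, h3, h2, ← hU.comp r s t hr hrs hst ht]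
    rfl
  strongly_continuous y :=
    continuousOn_compLp (L := fun p : ℝ × ℝ => U p.1 p.2) (M := M)
      (fun p hp => hM p.2 p.1 hp.1 hp.2.1 hp.2.2) hU.strongly_continuous y

/-- Applying `U t s` after superposing equals superposing with `U t s ∘ Ψ s`, and it is this
composite whose measurability in `s` is available. -/
theorem aestronglyMeasurable_evolution_superposition [IsFiniteMeasure P]
    (hM : ∀ s t, 0 ≤ s → s ≤ t → t ≤ T → ‖U t s‖ ≤ M) {Ψ : ℝ → X → X}
    (hΨ : ∀ s ∈ Icc 0 T, ∀ x y, ‖Ψ s x - Ψ s y‖ ≤ K * ‖x - y‖) {t : ℝ} (ht : t ∈ Icc 0 T)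
    (hm : ∀ c, AEStronglyMeasurable (fun s => U t s (Ψ s c)) (timeMeasure t))
    {z : ℝ → Lp X 2 P} (hz : ContinuousOn z (Icc 0 T)) :
    AEStronglyMeasurable (fun s => (U t s).compLpL 2 P (superposition P (Ψ s) (z s)))
      (timeMeasure t) := by
  have hsT : ∀ {s}, s ∈ Icc 0 t → s ∈ Icc 0 T := fun hs => ⟨hs.1, hs.2.trans ht.2⟩
  classical
  -- Extension by zero makes the Lipschitz bound valid for every `s`, as the superposition lemmas
  -- require.
  let Θ : ℝ → X → X := fun s c => if s ∈ Icc 0 t then U t s (Ψ s c) else 0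
  have hMK : ∀ s ∈ Icc 0 t, ∀ x y, ‖U t s (Ψ s x) - U t s (Ψ s y)‖ ≤ M * K * ‖x - y‖ := by
    intro s hs x y
    rw [← map_sub, mul_assoc]
    exact norm_evolution_apply_le hM hs.1 hs.2 ht.2 (hΨ s (hsT hs) x y)
  have hΘ : ∀ s, ∀ x y, ‖Θ s x - Θ s y‖ ≤ |M * K| * ‖x - y‖ := by
    intro s x y
    by_cases hs : s ∈ Icc 0 t
    · simp only [Θ, if_pos hs]
      exact (hMK s hs x y).trans (by gcongr; exact le_abs_self _)
    · simp only [Θ, if_neg hs, sub_self, norm_zero]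
      positivity
  have hΘm : ∀ c, AEStronglyMeasurable (fun s => Θ s c) (timeMeasure t) := fun c => by
    refine (hm c).congr ?_
    filter_upwards [ae_restrict_mem measurableSet_Icc] with s hs
    simp only [Θ, if_pos hs]
  have hzm : AEStronglyMeasurable z (timeMeasure t) :=
    (hz.mono (Icc_subset_Icc_right ht.2)).aestronglyMeasurable measurableSet_Icc
  refine (aestronglyMeasurable_apply_of_continuous (Ψ := fun s y => superposition P (Θ s) y)
    (ae_of_all _ fun s => continuous_of_norm_sub_le (norm_superposition_sub_le (hΘ s)))
    (aestronglyMeasurable_superposition hΘ hΘm) hzm).congr ?_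
  filter_upwards [ae_restrict_mem measurableSet_Icc] with s hs
  refine Lp.ext ?_
  filter_upwards [coeFn_superposition (hΘ s) (z s), coeFn_superposition (hΨ s (hsT hs)) (z s),
    (U t s).coeFn_compLpL (p := 2) (superposition P (Ψ s) (z s))] with ω h1 h2 h3
  rw [h1, h3, h2]
  simp only [Θ, if_pos hs]

end Lift

/-! ### The stochastic integral at time zero -/

section ZeroTime

variable {Ω : Type*} [MeasurableSpace Ω] {P : Measure Ω} {H T : ℝ}
  {ι Y : Type*} [NormedAddCommGroup Y] [InnerProductSpace ℝ Y] {B : QFBM H T P ι Y}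
  {X : Type*} [NormedAddCommGroup X] [InnerProductSpace ℝ X] [CompleteSpace X]

/-- Every integrand is null on the degenerate interval. This makes the mild formula compatible with
`φ 0` at the initial time. -/
theorem QFBM.IsStochasticIntegral.eq_zero_of_time_zero (hH : H ∈ Ioo (1 / 2 : ℝ) 1) (hT : 0 ≤ T)
    {Φ : ℝ → Y →L[ℝ] X} {Z : Lp X 2 P} (hZ : B.IsStochasticIntegral 0 Φ Z) : Z = 0 := by
  have hμ : timeMeasure 0 = 0 := by simp [timeMeasure]
  have hΦ : ∀ n, MemLp (fun s => √(B.lam n) • Φ s (B.e n)) 2 (timeMeasure 0) := fun n => by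
    rw [hμ]
    exact ⟨aestronglyMeasurable_zero_measure _, by simp⟩
  obtain ⟨I, hI, hIZ⟩ := hZ
  have h0 : ∀ n, I n = 0 := fun n => by
    rw [(isWienerIntegral_iff hH (B.fbm n) ⟨le_rfl, hT⟩ (hΦ n) _).1 (hI n)]
    have h := norm_wienerMap_le hH hT (B.fbm n) (memLp_indicator_timeMeasure hT (hΦ n)).toLp
    rw [Lp.norm_toLp, eLpNorm_indicator_timeMeasure hT, hμ, eLpNorm_measure_zero,
      ENNReal.toReal_zero, mul_zero] at h
    exact norm_le_zero_iff.1 h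
  rw [funext h0] at hIZ
  exact hIZ.unique hasSum_zero

end ZeroTime

end NeutralFBM

/-! ### Existence and uniqueness of the mild solution -/

open NeutralFBM in
theorem theorem3p1
    {Ω : Type*} [MeasurableSpace Ω] (P : Measure Ω) [IsProbabilityMeasure P]
    {X : Type*} [NormedAddCommGroup X] [InnerProductSpace ℝ X] [CompleteSpace X]
    [TopologicalSpace.SeparableSpace X]
    {Y : Type*} [NormedAddCommGroup Y] [InnerProductSpace ℝ Y] [CompleteSpace Y]
    [TopologicalSpace.SeparableSpace Y] {ι : Type*} [Countable ι]
    (H : ℝ) (hH : H ∈ Ioo (1 / 2 : ℝ) 1)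
    (T : ℝ) (hT : 0 < T) (τ : ℝ) (hτ : 0 < τ)
    -- the noise, the operators and their evolution family
    (B : NeutralFBM.QFBM H T P ι Y)
    (A : ℝ → X →ₗ.[ℝ] X) (U : ℝ → ℝ → X →L[ℝ] X) (hAU : NeutralFBM.Generates T A U)
    -- the coefficients, the delays and the initial datum
    (f g : ℝ → X → X) (σ : ℝ → Y →L[ℝ] X) (r ρ : ℝ → ℝ) (φ : ℝ → Lp X 2 P)
    -- exponential stability and bounded inverses
    (b M Mstar : ℝ) (hb : 0 < b) (hM : 1 ≤ M)
    (hU : ∀ s t, 0 ≤ s → s ≤ t → t ≤ T → ‖U t s‖ ≤ M * Real.exp (-b * (t - s)))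
    (hMstar : 0 < Mstar)
    (hAinv : ∀ t ∈ Icc 0 T, ∃ R : X →L[ℝ] X, NeutralFBM.IsInverse (A t) R ∧ ‖R‖ ≤ Mstar)
    -- continuity, Lipschitz and growth conditions on `f` and `g`
    (hf : ContinuousOn (fun p : ℝ × X => f p.1 p.2) (Icc 0 T ×ˢ univ))
    (hg : ContinuousOn (fun p : ℝ × X => g p.1 p.2) (Icc 0 T ×ˢ univ))
    (C₁ C₂ : ℝ) (hC₁ : 0 < C₁) (hC₂ : 0 < C₂)
    (hfLip : ∀ t ∈ Icc 0 T, ∀ x y, ‖f t x - f t y‖ ≤ C₁ * ‖x - y‖)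
    (hgLip : ∀ t ∈ Icc 0 T, ∀ x y, ‖g t x - g t y‖ ≤ C₁ * ‖x - y‖)
    (hfgrowth : ∀ t ∈ Icc 0 T, ∀ x, ‖f t x‖ ^ 2 ≤ C₂ * (1 + ‖x‖ ^ 2))
    (hggrowth : ∀ t ∈ Icc 0 T, ∀ x, ‖g t x‖ ^ 2 ≤ C₂ * (1 + ‖x‖ ^ 2))
    (hgdom : ∀ t ∈ Icc 0 T, ∀ x, g t x ∈ (A t).domain)
    (hAggrowth : ∀ t (ht : t ∈ Icc 0 T) (x : X),
      ‖A t ⟨g t x, hgdom t ht x⟩‖ ^ 2 ≤ C₂ * (1 + ‖x‖ ^ 2))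
    -- Lipschitz condition on `A(t) g(t, ·)` and mean square continuity of `g`
    (Lstar : ℝ) (hLstar : 0 < Lstar) (hLM : Lstar < 1 / Mstar)
    (hAgLip : ∀ t (ht : t ∈ Icc 0 T) (x y : X),
      ‖A t ⟨g t x, hgdom t ht x⟩ - A t ⟨g t y, hgdom t ht y⟩‖ ≤ Lstar * ‖x - y‖)
    (hgms : ∀ y : ℝ → Lp X 2 P, ContinuousOn y (Icc 0 T) → ∀ s ∈ Icc 0 T,
      Tendsto (fun t => eLpNorm (fun ω => g t (y t ω) - g s (y s ω)) 2 P)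
        (𝓝[Icc 0 T] s) (𝓝 0))
    -- `σ` is a measurable bounded function with values in the `Q`-Hilbert–Schmidt operators
    (hσmeas : ∀ n, AEStronglyMeasurable (fun s => Real.sqrt (B.lam n) • σ s (B.e n))
      (volume.restrict (Icc 0 T)))
    (L : ℝ) (hL : 0 < L)
    (hσ : ∀ t ∈ Icc 0 T, B.IsQHilbertSchmidt (σ t) ∧ B.qNorm (σ t) ≤ L)
    -- continuous delays
    (hr : ContinuousOn r (Icc 0 T)) (hρ : ContinuousOn ρ (Icc 0 T))
    (hrτ : ∀ t ∈ Icc 0 T, t - r t ∈ Icc (-τ) t)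
    (hρτ : ∀ t ∈ Icc 0 T, t - ρ t ∈ Icc (-τ) t)
    -- the initial datum
    (hφ : ContinuousOn φ (Icc (-τ) 0)) :
    ∃ x : ℝ → Lp X 2 P,
      NeutralFBM.IsMildSolution τ A U f g r ρ σ B φ x ∧
      ∀ y : ℝ → Lp X 2 P, NeutralFBM.IsMildSolution τ A U f g r ρ σ B φ y →
        ∀ t ∈ Icc (-τ) T, y t = x t := by
  have hT0 : (0 : ℝ) ∈ Icc 0 T := ⟨le_rfl, hT.le⟩
  -- On a finite horizon only the uniform bound matters; the decay factor is at most one.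
  have hUM : ∀ s t, 0 ≤ s → s ≤ t → t ≤ T → ‖U t s‖ ≤ M := fun s t hs hst ht =>
    (hU s t hs hst ht).trans (mul_le_of_le_one_right (by linarith)
      (Real.exp_le_one_iff.2 (by nlinarith)))
  have hV := hAU.evolution.compLpL (P := P) hUM
  have hVM : ∀ s t, 0 ≤ s → s ≤ t → t ≤ T → ‖(U t s).compLpL 2 P‖ ≤ M := fun s t hs hst ht =>
    (ContinuousLinearMap.norm_compLpL_le _).trans (hUM s t hs hst ht)
  classical
  let Ag : ℝ → X → X := fun s c => if hs : s ∈ Icc 0 T then A s ⟨g s c, hgdom s hs c⟩ else 0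
  have hAg : ∀ s (hs : s ∈ Icc 0 T) c, Ag s c = A s ⟨g s c, hgdom s hs c⟩ :=
    fun s hs c => dif_pos hs
  have hAgL : ∀ t ∈ Icc 0 T, ∀ x y, ‖Ag t x - Ag t y‖ ≤ Lstar * ‖x - y‖ := fun t ht x y => by
    rw [hAg t ht, hAg t ht]
    exact hAgLip t ht x y
  -- Applying the bounded inverse to `A(t) g(t, ·)` gives the constant `Mstar * Lstar`, which is
  -- below one and drives the contraction.
  have hgL : ∀ t ∈ Icc 0 T, ∀ x y, ‖g t x - g t y‖ ≤ Mstar * Lstar * ‖x - y‖ := by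
    intro t ht x y
    obtain ⟨R, hR, hRM⟩ := hAinv t ht
    have h1 : ∀ z, R (A t ⟨g t z, hgdom t ht z⟩) = g t z := fun z => hR.2 ⟨g t z, hgdom t ht z⟩
    have h2 : g t x - g t y = R (A t ⟨g t x, hgdom t ht x⟩ - A t ⟨g t y, hgdom t ht y⟩) := by
      rw [map_sub, h1, h1]
    rw [h2, mul_assoc]
    exact (R.le_opNorm _).trans (mul_le_mul hRM (hAgLip t ht x y) (norm_nonneg _) hMstar.le)
  have hk1 : Mstar * Lstar < 1 := by
    rwa [lt_div_iff₀ hMstar, mul_comm] at hLM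
  have hzero : ∀ v : X, ‖v‖ ^ 2 ≤ C₂ * (1 + ‖(0 : X)‖ ^ 2) → ‖v‖ ≤ √C₂ := fun v hv =>
    Real.le_sqrt_of_sq_le (by simpa using hv)
  have hAgm : ∀ t ∈ Icc 0 T, ∀ c,
      AEStronglyMeasurable (fun s => U t s (Ag s c)) (timeMeasure t) := by
    intro t ht c
    obtain ⟨R, hR, -⟩ := hAinv 0 hT0
    exact hAU.aestronglyMeasurable_apply_generator hR (h := fun s => g s c)
      (hg.comp (f := fun s => (s, c)) (by fun_prop) fun s hs => ⟨hs, mem_univ _⟩)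
      (fun s hs => ⟨hgdom s hs c, (hAg s hs c).symm⟩) ht
  have hfm : ∀ t ∈ Icc 0 T, ∀ c,
      AEStronglyMeasurable (fun s => U t s (f s c)) (timeMeasure t) := by
    intro t ht c
    have hc : ContinuousOn (fun s => f s c) (Icc 0 T) :=
      hf.comp (f := fun s => (s, c)) (by fun_prop) fun s hs => ⟨hs, mem_univ _⟩
    exact hAU.evolution.aestronglyMeasurable_apply ht
      ((hc.mono (Icc_subset_Icc_right ht.2)).aestronglyMeasurable measurableSet_Icc)
  have hKm : ∀ z : ℝ → Lp X 2 P, ContinuousOn z (Icc 0 T) → ∀ t ∈ Icc 0 T, AEStronglyMeasurable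
      (fun s => (U t s).compLpL 2 P (superposition P (Ag s) (z s))) (timeMeasure t) :=
    fun z hz t ht => aestronglyMeasurable_evolution_superposition hUM hAgL ht (hAgm t ht) hz
  have hFm : ∀ z : ℝ → Lp X 2 P, ContinuousOn z (Icc 0 T) → ∀ t ∈ Icc 0 T, AEStronglyMeasurable
      (fun s => (U t s).compLpL 2 P (superposition P (f s) (z s))) (timeMeasure t) :=
    fun z hz t ht => aestronglyMeasurable_evolution_superposition hUM hfLip ht (hfm t ht) hz
  -- The mean square continuity assumption on `g` is exactly continuity of its superposition along a
  -- continuous path.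
  have hGc : ∀ z : ℝ → Lp X 2 P, ContinuousOn z (Icc 0 T) →
      ContinuousOn (fun t => superposition P (g t) (z t)) (Icc 0 T) := by
    intro z hz s hs
    refine (Lp.tendsto_Lp_iff_tendsto_eLpNorm' _ _).2 ((hgms z hz s hs).congr' ?_)
    filter_upwards [self_mem_nhdsWithin] with t ht
    refine eLpNorm_congr_ae ?_
    filter_upwards [coeFn_superposition (hgL t ht) (z t), coeFn_superposition (hgL s hs) (z s)]
      with ω h1 h2
    rw [Pi.sub_apply, h1, h2]
  have hψ := fun t (ht : t ∈ Icc 0 T) n =>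
    memLp_evolution_comp hAU.evolution hUM hσmeas hL.le hσ ht n
  have hZex : ∀ t, ∃ Z : Lp X 2 P, t ∈ Icc 0 T →
      B.IsStochasticIntegral t (fun s => (U t s).comp (σ s)) Z := by
    intro t
    by_cases ht : t ∈ Icc 0 T
    · obtain ⟨Z, hZ⟩ := B.exists_isStochasticIntegral hH ht (hψ t ht)
        (tsum_eLpNorm_evolution_comp_ne_top hAU.evolution hUM hσmeas hL.le hσ ht)
      exact ⟨Z, fun _ => hZ⟩
    · exact ⟨0, fun h => absurd h ht⟩
  choose Z hZ using hZex
  have hZc := continuousOn_of_isStochasticIntegral_evolution hAU.evolution hUM hσmeas hL.le hσ hH hZ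
  have hsK : ∀ t ∈ Icc 0 T, ∀ x y : Lp X 2 P,
      ‖superposition P (Ag t) x - superposition P (Ag t) y‖ ≤ Lstar * ‖x - y‖ :=
    fun t ht => norm_superposition_sub_le (hAgL t ht)
  have hsF : ∀ t ∈ Icc 0 T, ∀ x y : Lp X 2 P,
      ‖superposition P (f t) x - superposition P (f t) y‖ ≤ C₁ * ‖x - y‖ :=
    fun t ht => norm_superposition_sub_le (hfLip t ht)
  have hK0 : ∀ t ∈ Icc 0 T, ‖superposition P (Ag t) 0‖ ≤ √C₂ := fun t ht =>
    norm_superposition_zero_le (hAgL t ht) (Real.sqrt_nonneg _) (hzero _ (by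
      rw [hAg t ht]
      exact hAggrowth t ht 0))
  have hF0 : ∀ t ∈ Icc 0 T, ‖superposition P (f t) 0‖ ≤ √C₂ := fun t ht =>
    norm_superposition_zero_le (hfLip t ht) (Real.sqrt_nonneg _) (hzero _ (hfgrowth t ht 0))
  obtain ⟨x, ⟨hxc, hxφ, hx⟩, huniq⟩ := exists_unique_neutral (E := Lp X 2 P)
    (G := fun t => superposition P (g t)) (K := fun t => superposition P (Ag t))
    (F := fun t => superposition P (f t)) (r := r) (ρ := ρ) hT.le hτ.le hV hVM
    (mul_pos hMstar hLstar).le hk1 hLstar.le hC₁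
    (fun t ht => norm_superposition_sub_le (hgL t ht)) hsK hsF hGc hK0 hF0 hKm hFm hr hρ hrτ hρτ
    hZc ((hZ 0 hT0).eq_zero_of_time_zero hH hT.le) hφ
  refine ⟨x, ⟨hxc, hxφ, superposition P (g 0) (φ (-r 0)),
    fun s => superposition P (g s) (x (s - r s)), fun s => superposition P (Ag s) (x (s - r s)),
    fun s => superposition P (f s) (x (s - ρ s)), Z, coeFn_superposition (hgL 0 hT0) _,
    fun s hs => coeFn_superposition (hgL s hs) _, fun s hs => ?_,
    fun s hs => coeFn_superposition (hfLip s hs) _, fun t ht => ⟨?_, ?_, hZ t ht, hx t ht⟩⟩, ?_⟩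
  · filter_upwards [coeFn_superposition (hAgL s hs) (x (s - r s))] with ω hω
    exact ⟨hgdom s hs _, by rw [hω, hAg s hs]⟩
  · have hz := continuousOn_comp_delay hxc hr hrτ
    obtain ⟨D, hD⟩ := exists_bound_of_lipschitz hLstar.le hsK hK0 hz
    exact intervalIntegrable_evolution_apply hVM hD ht (hKm _ hz t ht)
  · have hz := continuousOn_comp_delay hxc hρ hρτ
    obtain ⟨D, hD⟩ := exists_bound_of_lipschitz hC₁.le hsF hF0 hz
    exact intervalIntegrable_evolution_apply hVM hD ht (hFm _ hz t ht)
  · rintro y ⟨hyc, hyφ, G₀, G, AG, F, Z', hG₀, hG, hAG, hF, hy⟩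
    refine huniq y hyc hyφ fun t ht => ?_
    obtain ⟨-, -, hZ', hyt⟩ := hy t ht
    -- Each auxiliary variable of a competing solution is determined almost surely, and its
    -- stochastic integral is unique, so it solves the same fixed point equation.
    have e0 : G₀ = superposition P (g 0) (φ (-r 0)) := Lp.ext (by
      filter_upwards [hG₀, coeFn_superposition (hgL 0 hT0) (φ (-r 0))] with ω h1 h2
      rw [h1, h2])
    have e1 : G t = superposition P (g t) (y (t - r t)) := Lp.ext (by
      filter_upwards [hG t ht, coeFn_superposition (hgL t ht) (y (t - r t))] with ω h1 h2
      rw [h1, h2])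
    have e2 : ∀ s ∈ Icc 0 T, AG s = superposition P (Ag s) (y (s - r s)) := fun s hs => Lp.ext (by
      filter_upwards [hAG s hs, coeFn_superposition (hAgL s hs) (y (s - r s))] with ω h1 h2
      obtain ⟨h3, h4⟩ := h1
      rw [h4, h2, hAg s hs])
    have e3 : ∀ s ∈ Icc 0 T, F s = superposition P (f s) (y (s - ρ s)) := fun s hs => Lp.ext (by
      filter_upwards [hF s hs, coeFn_superposition (hfLip s hs) (y (s - ρ s))] with ω h1 h2
      rw [h1, h2])
    have e4 : Z' t = Z t := hZ'.unique hH ht (hψ t ht) (hZ t ht)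
    have hsT : ∀ s ∈ uIcc 0 t, s ∈ Icc 0 T := fun s hs => by
      rw [uIcc_of_le ht.1] at hs
      exact ⟨hs.1, hs.2.trans ht.2⟩
    rw [hyt, e0, e1, e4, intervalIntegral.integral_congr (g := fun s =>
        (U t s).compLp (superposition P (Ag s) (y (s - r s)))) fun s hs => by
        simp only [e2 s (hsT s hs)],
      intervalIntegral.integral_congr (f := fun s => (U t s).compLp (F s)) (g := fun s =>
        (U t s).compLp (superposition P (f s) (y (s - ρ s)))) fun s hs => by
        simp only [e3 s (hsT s hs)]]
    rfl
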